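/- Let $\mathbb{F}$ be a field and $G$ an abelian group. Algebras are $\mathbb{F}$-vector spaces with a bilinear product (not necessarily associative, unital or finite-dimensional). For an abelian group $K$, a $K$-grading on an algebra $\mathcal{A}$ is a decomposition $\mathcal{A}=\bigoplus_{k\in K}\mathcal{A}_k$ with $\mathcal{A}_k\mathcal{A}_l\subseteq\mathcal{A}_{kl}$, and $\mathcal{A}\simeq_K\mathcal{A}'$ means that there is an algebra isomorphism $\varphi$ with $\varphi(\mathcal{A}_k)=\mathcal{A}'_k$ for all $k\in K$. The centroid is $C(\mathcal{A})=\{c\in\mathrm{End}_{\mathbb{F}}(\mathcal{A})\mid c(xy)=c(x)y=xc(y)\ \forall x,y\in\mathcal{A}\}$. An algebra is *central simple* if it is nonzero, $\mathcal{A}^2=\mathcal{A}$, its only ideals are $0$ and $\mathcal{A}$, and $C(\mathcal{A})=\mathbb{F}1$. A $G$-graded algebra $\mathcal{B}$ is *graded-central-simple* if it is nonzero, $\mathcal{B}^2=\mathcal{B}$, its only graded ideals are $0$ and $\mathcal{B}$, and the only $c\in C(\mathcal{B})$ with $c(\mathcal{B}_g)\subseteq\mathcal{B}_g$ for all $g\in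 G$ are the scalars. For abelian groups $K$, $E$ let $\mathrm{Z}^2_{\mathrm{sym}}(K,E)$ be the group of symmetric $2$-cocycles $K\times K\to E$ (trivial action), $\mathrm{B}^2(K,E)$ the subgroup of coboundaries $(k,l)\mapsto\gamma(k)\gamma(l)\gamma(kl)^{-1}$ with $\gamma:K\to E$ any map, and $\mathrm{H}^2_{\mathrm{sym}}(K,E)=\mathrm{Z}^2_{\mathrm{sym}}(K,E)/\mathrm{B}^2(K,E)$. For a $K$-graded algebra $\mathcal{A}$ and $\tau\in\mathrm{Z}^2_{\mathrm{sym}}(K,\mathbb{F}^\times)$, the twist $\mathcal{A}^\tau$ is the graded space $\mathcal{A}$ with the product $x*y=\tau(k,l)xy$ for $x\in\mathcal{A}_k$, $y\in\mathcal{A}_l$. Let $H$ be a subgroup of $G$, with projection $\pi:G\to G/H$. For a $G/H$-graded algebra $\mathcal{A}$, let $L_\pi(\mathcal{A})=\bigoplus_{g\in G}\mathcal{A}_{\pi(g)}\otimes g\subseteq\mathcal{A}\otimes_{\mathbb{F}}\mathbb{F}G$ (the loop algebra, a $G$-graded algebra), and for $\tau\in\mathrm{Z}^2_{\mathrm{sym}}(G,\mathbb{F}^\times)$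 let $L_\pi^\tau(\mathcal{A})=(L_\pi(\mathcal{A}))^\tau$. Fix for each $H$ a section $s_H:G/H\to G$ of $\pi$; for $\chi\in\mathrm{Hom}(H,\mathbb{F}^\times)$ let $\mathcal{A}_\chi=\mathcal{A}^{\chi\circ\sigma}$, where $\sigma(x,y)=s_H(x)s_H(y)s_H(xy)^{-1}\in H$. Call two central simple $G/H$-graded algebras equivalent, $\mathcal{A}_1\sim\mathcal{A}_2$, if $(\mathcal{A}_1)_\chi\simeq_{G/H}\mathcal{A}_2$ for some $\chi\in\mathrm{Hom}(H,\mathbb{F}^\times)$; this is an equivalence relation. For every subgroup $H$ of $G$ fix a (set-theoretic) section $\xi_H:\mathrm{H}^2_{\mathrm{sym}}(H,\mathbb{F}^\times)\to\mathrm{H}^2_{\mathrm{sym}}(G,\mathbb{F}^\times)$ of the restriction map $[\tau]\mapsto[\tau|_{H\times H}]$. Let $\overline{\mathfrak{A}}'(G,\mathbb{F})$ be the set of triples $(H,[\tau'],[\mathcal{A}])$ with $H$ a subgroup of $G$, $[\tau']\in\mathrm{H}^2_{\mathrm{sym}}(H,\mathbb{F}^\times)$, and $[\mathcal{A}]$ the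 $\sim$-class of a central simple $G/H$-graded algebra $\mathcal{A}$, and let $\overline{\mathfrak{B}}(G,\mathbb{F})$ be the set of $\simeq_G$-classes of $G$-graded-central-simple algebras. **Corollary.** The algebras $L_\pi^\tau(\mathcal{A})$, with $H$ a subgroup of $G$, $\mathcal{A}$ a central simple $G/H$-graded algebra and $\tau\in\mathrm{Z}^2_{\mathrm{sym}}(G,\mathbb{F}^\times)$, are $G$-graded-central-simple, and the map $$\overline{\mathfrak{A}}'(G,\mathbb{F})\longrightarrow\overline{\mathfrak{B}}(G,\mathbb{F}),\qquad (H,[\tau'],[\mathcal{A}])\mapsto[L_\pi^\tau(\mathcal{A})],$$ where $\tau$ is any cocycle in $\mathrm{Z}^2_{\mathrm{sym}}(G,\mathbb{F}^\times)$ with $[\tau]=\xi_H([\tau'])$, is well defined and bijective. -/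

import Mathlib

universe u v w

/-! ### Symmetric 2-cocycles and symmetric second cohomology -/

namespace SymCoh

/-- The group of symmetric 2-cocycles `A × A → B` (trivial action). -/
def Z2sym (A B : Type*) [CommGroup A] [CommGroup B] : Subgroup (A → A → B) where
  carrier := {σ | (∀ a₁ a₂ a₃, σ a₁ a₂ * σ (a₁ * a₂) a₃ = σ a₁ (a₂ * a₃) * σ a₂ a₃) ∧
    ∀ a₁ a₂, σ a₁ a₂ = σ a₂ a₁}
  one_mem' := by simp
  mul_mem' := by
    rintro σ τ ⟨hσ, hσ'⟩ ⟨hτ, hτ'⟩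
    refine ⟨fun a b c => ?_, fun a b => ?_⟩
    · simp only [Pi.mul_apply]
      rw [mul_mul_mul_comm, hσ, hτ, mul_mul_mul_comm]
    · simp only [Pi.mul_apply]
      rw [hσ', hτ']
  inv_mem' := by
    rintro σ ⟨hσ, hσ'⟩
    refine ⟨fun a b c => ?_, fun a b => ?_⟩
    · simp only [Pi.inv_apply]
      rw [← mul_inv, ← mul_inv, hσ]
    · simp only [Pi.inv_apply]
      rw [hσ']

/-- The coboundary map `(dγ)(a₁, a₂) = γ(a₁) γ(a₂) γ(a₁ a₂)⁻¹`. -/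
def d (A B : Type*) [CommGroup A] [CommGroup B] : (A → B) →* (A → A → B) where
  toFun γ := fun a₁ a₂ => γ a₁ * γ a₂ * (γ (a₁ * a₂))⁻¹
  map_one' := by ext; simp
  map_mul' γ γ' := by
    ext a b
    simp only [Pi.mul_apply, mul_inv]
    ac_rfl

/-- The group of 2-coboundaries. -/
def B2 (A B : Type*) [CommGroup A] [CommGroup B] : Subgroup (A → A → B) := (d A B).range

/-- `H²_sym(A, B) = Z²_sym(A, B) / B²(A, B)`. -/
abbrev H2sym (A B : Type*) [CommGroup A] [CommGroup B] : Type _ :=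
  Z2sym A B ⧸ (B2 A B).subgroupOf (Z2sym A B)

/-- Pullback of symmetric cocycles along a homomorphism: `σ ↦ σ ∘ (f × f)`. -/
def Z2sym.pullback {A A' : Type*} (B : Type*) [CommGroup A] [CommGroup A'] [CommGroup B]
    (f : A' →* A) : Z2sym A B →* Z2sym A' B where
  toFun σ := ⟨fun a₁ a₂ => σ.1 (f a₁) (f a₂),
    fun a₁ a₂ a₃ => by simpa only [map_mul] using σ.2.1 (f a₁) (f a₂) (f a₃),
    fun a₁ a₂ => σ.2.2 _ _⟩
  map_one' := rfl
  map_mul' _ _ := rfl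

/-- The map `f^* : H²_sym(A, B) → H²_sym(A', B)`, `[σ] ↦ [σ ∘ (f × f)]`. -/
def H2sym.pullback {A A' : Type*} (B : Type*) [CommGroup A] [CommGroup A'] [CommGroup B]
    (f : A' →* A) : H2sym A B →* H2sym A' B :=
  QuotientGroup.map _ _ (Z2sym.pullback B f) (by
    rintro ⟨σ, hσ⟩ ⟨γ, hγ⟩
    refine ⟨γ ∘ f, ?_⟩
    subst hγ
    ext a b
    simp [d, Z2sym.pullback])

end SymCoh

/-! ### Sections of `G → G/H` and the associated cocycles -/

/-- A (set-theoretic) section of the canonical projection `G → G/H`. -/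
def QuotSection {G : Type*} [CommGroup G] (H : Subgroup G) : Type _ :=
  {s : G ⧸ H → G // ∀ x, (QuotientGroup.mk (s x) : G ⧸ H) = x}

namespace QuotSection

variable {G : Type*} [CommGroup G] {H : Subgroup G}

/-- The element `s(x) s(y) s(xy)⁻¹` of `H`. -/
def sigma (s : QuotSection H) (x y : G ⧸ H) : H :=
  ⟨s.1 x * s.1 y * (s.1 (x * y))⁻¹, by
    rw [← QuotientGroup.eq_one_iff]
    simp [QuotientGroup.mk_mul, QuotientGroup.mk_inv, s.2]⟩

/-- For a homomorphism `χ : H → B`, the symmetric cocycle `χ ∘ σ` on `G/H`. -/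
def charCocycle {B : Type*} [CommGroup B] (s : QuotSection H) (χ : H →* B) :
    SymCoh.Z2sym (G ⧸ H) B :=
  ⟨fun x y => χ (s.sigma x y), fun x y z => by
      rw [← map_mul, ← map_mul]
      congr 1
      ext
      simp only [sigma, Subgroup.coe_mul, mul_assoc x y z]
      generalize s.1 x = a
      generalize s.1 y = b
      generalize s.1 z = c
      generalize s.1 (x * y) = e
      generalize s.1 (y * z) = f
      generalize s.1 (x * (y * z)) = k
      have h1 : a * b * e⁻¹ * (e * c * k⁻¹) = a * b * c * k⁻¹ := by group
      have h2 : a * f * k⁻¹ * (b * c * f⁻¹) = a * b * c * k⁻¹ * (f * f⁻¹) := by ac_rfl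
      rw [h1, h2]; simp,
    fun x y => by
      have h : s.sigma x y = s.sigma y x := by
        ext
        simp only [sigma]
        rw [mul_comm (s.1 x), mul_comm x]
      simp only [h]⟩

end QuotSection

/-! ### Algebras (vector spaces with a bilinear product): ideals, centroid, simplicity -/

namespace BilinAlg

variable {F : Type*} [Field F] {A : Type*} [AddCommGroup A] [Module F A]

/-- Two-sided ideals of the algebra `A` with product `m`. -/
def IsIdeal (m : A →ₗ[F] A →ₗ[F] A) (I : Submodule F A) : Prop :=
  ∀ a, ∀ x ∈ I, m a x ∈ I ∧ m x a ∈ I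

/-- The centroid, `{c ∈ End_F(A) | c(xy) = c(x)y = xc(y)}`. -/
def centroid (m : A →ₗ[F] A →ₗ[F] A) : Subalgebra F (Module.End F A) where
  carrier := {c | ∀ x y, c (m x y) = m (c x) y ∧ c (m x y) = m x (c y)}
  mul_mem' := by
    intro c c' hc hc' x y
    simp only [Module.End.mul_apply]
    exact ⟨by rw [(hc' x y).1, (hc _ _).1], by rw [(hc' x y).2, (hc _ _).2]⟩
  add_mem' := by
    intro c c' hc hc' x y
    simp only [LinearMap.add_apply, map_add]
    exact ⟨by rw [(hc x y).1, (hc' x y).1], by rw [(hc x y).2, (hc' x y).2]⟩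
  algebraMap_mem' := by
    intro r x y
    simp [Module.algebraMap_end_apply]

/-- `A` is simple: `A ≠ 0`, `A² = A`, and the only ideals are `0` and `A`. -/
def IsSimple (m : A →ₗ[F] A →ₗ[F] A) : Prop :=
  Nontrivial A ∧ Submodule.map₂ m ⊤ ⊤ = ⊤ ∧
    ∀ I : Submodule F A, IsIdeal m I → I = ⊥ ∨ I = ⊤

/-- `A` is central simple: it is simple with centroid `F 1`. -/
def IsCentralSimple (m : A →ₗ[F] A →ₗ[F] A) : Prop :=
  IsSimple m ∧ centroid m = ⊥

end BilinAlg

/-! ### Graded algebras -/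

/-- An algebra over `F` (a vector space with an arbitrary bilinear product) with a `G`-grading. -/
structure GradedAlg (F : Type u) [Field F] (G : Type v) [CommGroup G] where
  carrier : Type w
  [addCommGroup : AddCommGroup carrier]
  [module : Module F carrier]
  mul : carrier →ₗ[F] carrier →ₗ[F] carrier
  comp : G → Submodule F carrier
  indep : iSupIndep comp
  iSup_eq_top : ⨆ g, comp g = ⊤
  mul_mem : ∀ g h x y, x ∈ comp g → y ∈ comp h → mul x y ∈ comp (g * h)

namespace GradedAlg

attribute [instance] GradedAlg.addCommGroup GradedAlg.module

section

variable {F : Type u} [Field F] {G : Type v} [CommGroup G]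

/-- Graded isomorphism: an algebra isomorphism `φ` with `φ(A_g) = B_g` for all `g`. -/
def Iso (A B : GradedAlg.{u, v, w} F G) : Prop :=
  ∃ φ : A.carrier ≃ₗ[F] B.carrier, (∀ x y, φ (A.mul x y) = B.mul (φ x) (φ y)) ∧
    ∀ g, (A.comp g).map (φ : A.carrier →ₗ[F] B.carrier) = B.comp g

/-- Graded ideals: ideals `I` with `I = ⨁ (I ∩ A_g)`. -/
def IsGradedIdeal (A : GradedAlg.{u, v, w} F G) (I : Submodule F A.carrier) : Prop :=
  BilinAlg.IsIdeal A.mul I ∧ I = ⨆ g, I ⊓ A.comp g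

/-- `C(A)_g = {c ∈ C(A) | c A_{g'} ⊆ A_{gg'} for all g'}`. -/
def centroidComp (A : GradedAlg.{u, v, w} F G) (g : G) : Submodule F (Module.End F A.carrier) where
  carrier := {c | c ∈ BilinAlg.centroid A.mul ∧ ∀ g', ∀ x ∈ A.comp g', c x ∈ A.comp (g * g')}
  add_mem' := by
    rintro a b ⟨ha, ha'⟩ ⟨hb, hb'⟩
    exact ⟨add_mem ha hb, fun g' x hx => add_mem (ha' g' x hx) (hb' g' x hx)⟩
  zero_mem' := ⟨zero_mem _, fun g' x _ => zero_mem _⟩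
  smul_mem' := by
    rintro r a ⟨ha, ha'⟩
    exact ⟨Subalgebra.smul_mem _ ha r, fun g' x hx => Submodule.smul_mem _ r (ha' g' x hx)⟩

/-- Graded-central: `C(A)_e = F 1`. -/
def IsGradedCentral (A : GradedAlg.{u, v, w} F G) : Prop :=
  A.centroidComp 1 = Submodule.span F {1}

/-- Graded-simple: `A ≠ 0`, `A² = A`, and the only graded ideals are `0` and `A`. -/
def IsGradedSimple (A : GradedAlg.{u, v, w} F G) : Prop :=
  Nontrivial A.carrier ∧ Submodule.map₂ A.mul ⊤ ⊤ = ⊤ ∧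
    ∀ I, A.IsGradedIdeal I → I = ⊥ ∨ I = ⊤

/-- Graded-central-simple. -/
def IsGradedCentralSimple (A : GradedAlg.{u, v, w} F G) : Prop :=
  A.IsGradedSimple ∧ A.IsGradedCentral

/-- Central simple as an ungraded algebra. -/
def IsCentralSimple (A : GradedAlg.{u, v, w} F G) : Prop :=
  BilinAlg.IsCentralSimple A.mul

/-! #### Cocycle twists -/

open Classical in
/-- The decomposition of `A` as the direct sum of its homogeneous components. -/
noncomputable def decomp (A : GradedAlg.{u, v, w} F G) :
    (DirectSum G fun g => A.comp g) ≃ₗ[F] A.carrier :=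
  LinearEquiv.ofBijective (DirectSum.coeLinearMap A.comp)
    (DirectSum.isInternal_submodule_of_iSupIndep_of_iSup_eq_top A.indep A.iSup_eq_top)

open Classical in
theorem decomp_symm_of_mem (A : GradedAlg.{u, v, w} F G) {g : G} {x : A.carrier}
    (hx : x ∈ A.comp g) :
    A.decomp.symm x = DirectSum.lof F G (fun g => A.comp g) g ⟨x, hx⟩ := by
  rw [LinearEquiv.symm_apply_eq]
  exact (DirectSum.coeLinearMap_lof A.comp g ⟨x, hx⟩).symm

open Classical in
/-- The linear map acting on `A_g` as multiplication by the scalar `c g`. -/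
noncomputable def scale (A : GradedAlg.{u, v, w} F G) (c : G → F) : A.carrier →ₗ[F] A.carrier :=
  (DirectSum.toModule F G A.carrier fun g => c g • (A.comp g).subtype) ∘ₗ
    (A.decomp.symm : A.carrier →ₗ[F] _)

open Classical in
/-- The twisted product: `x * y = τ(g, h) x y` for `x ∈ A_g`, `y ∈ A_h` (see
`twistMul_of_mem`), extended bilinearly. -/
noncomputable def twistMul (A : GradedAlg.{u, v, w} F G) (τ : G → G → F) :
    A.carrier →ₗ[F] A.carrier →ₗ[F] A.carrier :=
  (DirectSum.toModule F G (A.carrier →ₗ[F] A.carrier) fun g =>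
    (A.mul ∘ₗ (A.comp g).subtype).compl₂ (A.scale (τ g))) ∘ₗ
    (A.decomp.symm : A.carrier →ₗ[F] _)

theorem scale_of_mem (A : GradedAlg.{u, v, w} F G) (c : G → F) {g : G} {x : A.carrier}
    (hx : x ∈ A.comp g) : A.scale c x = c g • x := by
  classical
  simp only [scale, LinearMap.comp_apply, LinearEquiv.coe_coe]
  rw [decomp_symm_of_mem A hx, DirectSum.toModule_lof]
  simp

theorem twistMul_of_mem (A : GradedAlg.{u, v, w} F G) (τ : G → G → F) {g h : G}
    {x y : A.carrier} (hx : x ∈ A.comp g) (hy : y ∈ A.comp h) :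
    A.twistMul τ x y = τ g h • A.mul x y := by
  classical
  simp only [twistMul, LinearMap.comp_apply, LinearEquiv.coe_coe]
  rw [decomp_symm_of_mem A hx, DirectSum.toModule_lof]
  simp [scale_of_mem A _ hy]

/-- The `τ`-twist `A^τ`. -/
noncomputable def twist (A : GradedAlg.{u, v, w} F G) (τ : SymCoh.Z2sym G Fˣ) :
    GradedAlg.{u, v, w} F G where
  carrier := A.carrier
  mul := A.twistMul fun g h => (τ.1 g h : F)
  comp := A.comp
  indep := A.indep
  iSup_eq_top := A.iSup_eq_top
  mul_mem g h x y hx hy := by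
    rw [twistMul_of_mem A _ hx hy]
    exact Submodule.smul_mem _ _ (A.mul_mem g h x y hx hy)

/-! #### Graded isomorphism is an equivalence relation -/

theorem Iso.refl (A : GradedAlg.{u, v, w} F G) : Iso A A :=
  ⟨LinearEquiv.refl F _, fun _ _ => rfl, fun g => by simp⟩

theorem Iso.symm {A B : GradedAlg.{u, v, w} F G} (h : Iso A B) : Iso B A := by
  obtain ⟨φ, hm, hc⟩ := h
  refine ⟨φ.symm, fun x y => ?_, fun g => ?_⟩
  · rw [LinearEquiv.symm_apply_eq, hm]; simp
  · rw [← hc g, ← Submodule.map_comp]; simp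

theorem Iso.trans {A B C : GradedAlg.{u, v, w} F G} (h : Iso A B) (h' : Iso B C) : Iso A C := by
  obtain ⟨φ, hm, hc⟩ := h
  obtain ⟨ψ, hm', hc'⟩ := h'
  refine ⟨φ.trans ψ, fun x y => by simp [hm, hm'], fun g => ?_⟩
  rw [← hc' g, ← hc g, ← Submodule.map_comp]; rfl

/-- Two bilinear maps that agree on homogeneous elements are equal. -/
theorem bilin_ext (A : GradedAlg.{u, v, w} F G) {M : Type*} [AddCommGroup M] [Module F M]
    (f f' : A.carrier →ₗ[F] A.carrier →ₗ[F] M)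
    (H : ∀ g h, ∀ x ∈ A.comp g, ∀ y ∈ A.comp h, f x y = f' x y) : f = f' := by
  ext x y
  have hx : x ∈ ⨆ g, A.comp g := by rw [A.iSup_eq_top]; trivial
  have hy : y ∈ ⨆ g, A.comp g := by rw [A.iSup_eq_top]; trivial
  refine Submodule.iSup_induction A.comp (motive := fun x => f x y = f' x y) hx
    (fun g x hx => ?_) (by simp) (fun a b ha hb => by simp [ha, hb])
  exact Submodule.iSup_induction A.comp (motive := fun y => f x y = f' x y) hy
    (fun h y hy => H g h x hx y hy) (by simp) (fun a b ha hb => by simp [ha, hb])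

theorem iso_twist_iff (A B : GradedAlg.{u, v, w} F G) (τ : SymCoh.Z2sym G Fˣ) :
    Iso (A.twist τ) B ↔ ∃ φ : A.carrier ≃ₗ[F] B.carrier,
      (∀ g h, ∀ x ∈ A.comp g, ∀ y ∈ A.comp h,
        (τ.1 g h : F) • φ (A.mul x y) = B.mul (φ x) (φ y)) ∧
      ∀ g, (A.comp g).map (φ : A.carrier →ₗ[F] B.carrier) = B.comp g := by
  have aux : ∀ φ : A.carrier ≃ₗ[F] B.carrier,
      (∀ x y, φ (A.twistMul (fun g h => (τ.1 g h : F)) x y) = B.mul (φ x) (φ y)) ↔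
      (∀ g h, ∀ x ∈ A.comp g, ∀ y ∈ A.comp h,
        (τ.1 g h : F) • φ (A.mul x y) = B.mul (φ x) (φ y)) := by
    refine fun φ => ⟨fun H g h x hx y hy => ?_, fun H => ?_⟩
    · have := H x y
      rwa [twistMul_of_mem A _ hx hy, map_smul] at this
    have key := bilin_ext A
      ((A.twistMul fun g h => (τ.1 g h : F)).compr₂ (φ : A.carrier →ₗ[F] B.carrier))
      (B.mul.compl₁₂ (φ : A.carrier →ₗ[F] B.carrier) (φ : A.carrier →ₗ[F] B.carrier))
      (fun g h x hx y hy => by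
        simp only [LinearMap.compr₂_apply, LinearMap.compl₁₂_apply, LinearEquiv.coe_coe]
        rw [twistMul_of_mem A _ hx hy, map_smul]
        exact H g h x hx y hy)
    exact fun x y => LinearMap.congr_fun (LinearMap.congr_fun key x) y
  exact exists_congr fun φ => and_congr_left fun _ => aux φ

variable (F G) in
/-- Graded isomorphism on the `G`-graded-central-simple algebras. -/
def gcsSetoid : Setoid {B : GradedAlg.{u, v, w} F G // B.IsGradedCentralSimple} where
  r B B' := Iso B.1 B'.1
  iseqv := ⟨fun B => Iso.refl B.1, Iso.symm, Iso.trans⟩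

variable (F G) in
/-- Isomorphism classes of `G`-graded-central-simple algebras. -/
def GCSClass : Type _ := Quotient (gcsSetoid.{u, v, w} F G)

end

/-! ### Loop algebras -/

section

variable {F : Type u} [Field F] {G : Type v} [CommGroup G] {H : Subgroup G}

/-- The product of `A ⊗ F G`, where the element `∑ a_g ⊗ g` is the finitely supported function
`g ↦ a_g`: `(a ⊗ g)(b ⊗ h) = ab ⊗ gh`. -/
noncomputable def groupAlgMul {A : Type*} [AddCommGroup A] [Module F A]
    (m : A →ₗ[F] A →ₗ[F] A) : (G →₀ A) →ₗ[F] (G →₀ A) →ₗ[F] (G →₀ A) :=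
  Finsupp.lsum F fun g => LinearMap.flip <| Finsupp.lsum F fun h =>
    (m.compr₂ (Finsupp.lsingle (g * h))).flip

theorem groupAlgMul_single {A : Type*} [AddCommGroup A] [Module F A]
    (m : A →ₗ[F] A →ₗ[F] A) (g h : G) (a b : A) :
    groupAlgMul m (Finsupp.single g a) (Finsupp.single h b) =
      Finsupp.single (g * h) (m a b) := by
  simp [groupAlgMul]

/-- The subspace `⨁_g A_{π(g)} ⊗ g` of `A ⊗ F G`, for a `G/H`-graded algebra `A`. -/
def loopSubmodule (A : GradedAlg.{u, v, w} F (G ⧸ H)) : Submodule F (G →₀ A.carrier) where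
  carrier := {f | ∀ g : G, f g ∈ A.comp (QuotientGroup.mk g)}
  add_mem' hf hf' g := add_mem (hf g) (hf' g)
  zero_mem' _ := zero_mem _
  smul_mem' r _ hf g := Submodule.smul_mem _ r (hf g)

theorem single_mem_loop (A : GradedAlg.{u, v, w} F (G ⧸ H)) {g : G} {a : A.carrier}
    (ha : a ∈ A.comp (QuotientGroup.mk g)) : Finsupp.single g a ∈ A.loopSubmodule := by
  classical
  intro k
  rw [Finsupp.single_apply]
  split_ifs with hk
  · exact hk ▸ ha
  · exact zero_mem _

theorem groupAlgMul_mem_loop (A : GradedAlg.{u, v, w} F (G ⧸ H)) {f f' : G →₀ A.carrier}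
    (hf : f ∈ A.loopSubmodule) (hf' : f' ∈ A.loopSubmodule) :
    groupAlgMul A.mul f f' ∈ A.loopSubmodule := by
  rw [← f.sum_single, ← f'.sum_single]
  simp only [Finsupp.sum, map_sum, LinearMap.sum_apply, groupAlgMul_single]
  refine Submodule.sum_mem _ fun g _ => Submodule.sum_mem _ fun h _ => ?_
  exact single_mem_loop A (A.mul_mem _ _ _ _ (hf _) (hf' _))

/-- The homogeneous component `A_{π(g)} ⊗ g` of the loop algebra. -/
def loopComp (A : GradedAlg.{u, v, w} F (G ⧸ H)) (g : G) : Submodule F A.loopSubmodule where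
  carrier := {f | ∀ k, k ≠ g → f.1 k = 0}
  add_mem' hf hf' k hk := by simp [hf k hk, hf' k hk]
  zero_mem' _ _ := rfl
  smul_mem' r _ hf k hk := by simp [hf k hk]

theorem loopComp_eq_single (A : GradedAlg.{u, v, w} F (G ⧸ H)) {g : G} {f : A.loopSubmodule}
    (hf : f ∈ A.loopComp g) : f.1 = Finsupp.single g (f.1 g) := by
  classical
  ext k
  rw [Finsupp.single_apply]
  split_ifs with hk
  · rw [hk]
  · exact hf k (Ne.symm hk)

/-- The loop algebra `L_π(A)`, as a `G`-graded algebra. -/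
noncomputable def loop (A : GradedAlg.{u, v, w} F (G ⧸ H)) : GradedAlg.{u, v, max v w} F G where
  carrier := A.loopSubmodule
  mul := LinearMap.mk₂ F
    (fun f f' => ⟨groupAlgMul A.mul f.1 f'.1, groupAlgMul_mem_loop A f.2 f'.2⟩)
    (fun _ _ _ => by ext1; simp) (fun _ _ _ => by ext1; simp)
    (fun _ _ _ => by ext1; simp) (fun _ _ _ => by ext1; simp)
  comp := A.loopComp
  indep := by
    intro g
    rw [Submodule.disjoint_def]
    intro f hf hf'
    have h0 : f.1 g = 0 := by
      have : ⨆ k, ⨆ (_ : k ≠ g), A.loopComp k ≤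
          LinearMap.ker (Finsupp.lapply g ∘ₗ A.loopSubmodule.subtype) :=
        iSup₂_le fun k hk x hx => hx g (Ne.symm hk)
      exact this hf'
    ext1
    rw [loopComp_eq_single A hf, h0]
    simp
  iSup_eq_top := by
    rw [eq_top_iff]
    intro f _
    have : f = ∑ g ∈ f.1.support,
        (⟨Finsupp.single g (f.1 g), single_mem_loop A (f.2 g)⟩ : A.loopSubmodule) := by
      ext1
      rw [AddSubmonoidClass.coe_finsetSum]
      exact f.1.sum_single.symm
    rw [this]
    refine Submodule.sum_mem _ fun g _ => Submodule.mem_iSup_of_mem g fun k hk => ?_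
    exact Finsupp.single_eq_of_ne hk
  mul_mem g h x y hx hy := by
    intro k hk
    change groupAlgMul A.mul x.1 y.1 k = 0
    rw [loopComp_eq_single A hx, loopComp_eq_single A hy, groupAlgMul_single]
    exact Finsupp.single_eq_of_ne hk

/-- The cocycle twisted loop algebra `L_π^τ(A) = (L_π(A))^τ`. -/
noncomputable def twistedLoop (A : GradedAlg.{u, v, w} F (G ⧸ H)) (τ : SymCoh.Z2sym G Fˣ) :
    GradedAlg.{u, v, max v w} F G :=
  A.loop.twist τ

/-! ### Character twists and the set of triples -/

/-- For a character `χ` of `H`, the algebra `A_χ = A^{χ ∘ σ}`, formed with the section `s`. -/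
noncomputable def charTwist (A : GradedAlg.{u, v, w} F (G ⧸ H)) (s : QuotSection H)
    (χ : H →* Fˣ) : GradedAlg.{u, v, w} F (G ⧸ H) :=
  A.twist (s.charCocycle χ)

variable (F) in
/-- The relation `A₁ ∼ A₂` iff `(A₁)_χ ≃ A₂` for some character `χ` of `H`, on the central
simple `G/H`-graded algebras. -/
def charSetoid (s : QuotSection H) :
    Setoid {A : GradedAlg.{u, v, w} F (G ⧸ H) // A.IsCentralSimple} where
  r A₁ A₂ := ∃ χ : H →* Fˣ, Iso (A₁.1.charTwist s χ) A₂.1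
  iseqv := by
    refine ⟨fun A => ⟨1, ?_⟩, ?_, ?_⟩
    · rw [charTwist, iso_twist_iff]
      exact ⟨LinearEquiv.refl F _, fun g h x _ y _ => by simp [QuotSection.charCocycle],
        fun g => by simp⟩
    · rintro A B ⟨χ, h⟩
      refine ⟨χ⁻¹, ?_⟩
      rw [charTwist, iso_twist_iff] at h ⊢
      obtain ⟨φ, hm, hc⟩ := h
      have hc' : ∀ g, (B.1.comp g).map (φ.symm : B.1.carrier →ₗ[F] A.1.carrier) = A.1.comp g :=
        fun g => by rw [← hc g, ← Submodule.map_comp]; simp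
      refine ⟨φ.symm, fun g h x hx y hy => ?_, hc'⟩
      have hx' : φ.symm x ∈ A.1.comp g := hc' g ▸ Submodule.mem_map_of_mem hx
      have hy' : φ.symm y ∈ A.1.comp h := hc' h ▸ Submodule.mem_map_of_mem hy
      have := hm g h _ hx' _ hy'
      simp only [LinearEquiv.apply_symm_apply] at this
      rw [← this, map_smul, smul_smul, LinearEquiv.symm_apply_apply]
      simp [QuotSection.charCocycle]
    · rintro A B C ⟨χ, h⟩ ⟨χ', h'⟩
      refine ⟨χ * χ', ?_⟩
      rw [charTwist, iso_twist_iff] at h h' ⊢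
      obtain ⟨φ, hm, hc⟩ := h
      obtain ⟨ψ, hm', hc'⟩ := h'
      refine ⟨φ.trans ψ, fun g h x hx y hy => ?_, fun g => ?_⟩
      · have hx' : φ x ∈ B.1.comp g := hc g ▸ Submodule.mem_map_of_mem hx
        have hy' : φ y ∈ B.1.comp h := hc h ▸ Submodule.mem_map_of_mem hy
        have e := hm' g h _ hx' _ hy'
        rw [← hm g h x hx y hy, map_smul, smul_smul] at e
        simp only [LinearEquiv.trans_apply]
        rw [← e, mul_comm]
        simp [QuotSection.charCocycle]
      · rw [← hc' g, ← hc g, ← Submodule.map_comp]; rfl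

variable (F) in
/-- Triples `(H, [τ'], [A])`: a subgroup `H` of `G`, a class `[τ'] ∈ H²_sym(H, F^×)`, and the class
of a central simple `G/H`-graded algebra `A` up to character twists. -/
def Triple (s : ∀ H : Subgroup G, QuotSection H) : Type _ :=
  Σ H : Subgroup G, SymCoh.H2sym H Fˣ × Quotient (charSetoid.{u, v, w} F (s H))

end

end GradedAlg

/-! The idea is to read off the triple from the centroid. Let `B` be graded-central-simple. Nonzero
homogeneous elements of its centroid are invertible, and there is only one in each degree up to
scalars, so their degrees form a subgroup `H` of `G` and their products define a class in
`H²_sym(H, F^×)`. Twisting `B` by the inverse of a cocycle on `G` whose restriction to `H` has this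
class makes the homogeneous elements of the centroid into a representation `Z` of `H`. Identifying
every `x` with all the `Z h x` then turns `B` into a `G/H`-graded algebra `A` whose loop algebra is
the twist of `B`.

Conversely, the homogeneous elements of the centroid of `L_π(A)` are the shifts of those of the
centroid of `A`. Hence `A` is graded-central-simple with the centroid supported in
degree `1` if and only if `L_π(A)` is graded-central-simple with support `H`, and an isomorphism of
loop algebras multiplies the shift by `h ∈ H` by a scalar `χ h`, which is the character relating the
two algebras.

It remains to see that a graded-central-simple algebra whose nonzero homogeneous elements of the
centroid all have degree `1` is simple without the grading, with scalar centroid. A nonzero element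
of minimal support in an ideal `J` yields a nonzero element of the centroid with image in `J`; as
it is a scalar, `J` is everything. -/

universe w₁ w₂

namespace SymCoh

variable {A B : Type*} [CommGroup A] [CommGroup B]

/-- The coboundary of `γ`, as a symmetric cocycle. -/
def coboundary (γ : A → B) : Z2sym A B :=
  ⟨d A B γ,
    fun a₁ a₂ a₃ => by
      simp only [d, MonoidHom.coe_mk, OneHom.coe_mk, ← div_eq_mul_inv, mul_assoc a₁,
        div_mul_div_comm, div_eq_div_iff_mul_eq_mul]
      generalize γ (a₁ * (a₂ * a₃)) = b
      ac_rfl,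
    fun a₁ a₂ => by simp only [d, MonoidHom.coe_mk, OneHom.coe_mk, mul_comm]⟩

theorem coboundary_apply_mul (γ : A → B) (a₁ a₂ : A) :
    (coboundary γ).1 a₁ a₂ * γ (a₁ * a₂) = γ a₁ * γ a₂ :=
  inv_mul_cancel_right _ _

theorem mk_eq_mk_iff {τ τ' : Z2sym A B} :
    (τ : H2sym A B) = τ' ↔ ∃ γ : A → B, τ' = τ * coboundary γ := by
  rw [QuotientGroup.eq]
  refine exists_congr fun γ => ?_
  rw [← inv_mul_eq_iff_eq_mul, eq_comm, Subtype.ext_iff]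
  rfl

theorem Z2sym.apply_one_left (τ : Z2sym A B) (a : A) : τ.1 1 a = τ.1 1 1 := by
  have h := τ.2.1 1 1 a
  simp only [one_mul] at h
  exact (mul_right_cancel h).symm

end SymCoh

namespace QuotSection

variable {G : Type*} [CommGroup G] {H : Subgroup G} (s : QuotSection H)

/-- The element `s(gH) g⁻¹` of `H`, which moves `g` to the chosen representative of its coset. -/
def offset (g : G) : H :=
  ⟨s.1 g * g⁻¹, by rw [← QuotientGroup.eq_one_iff]; simp [s.2]⟩

theorem offset_mul_coe (g : G) : (s.offset g : G) * g = s.1 g := by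
  simp [offset]

theorem offset_section (z : G ⧸ H) : s.offset (s.1 z) = 1 := by
  ext
  simp [offset, s.2]

theorem offset_coe_mul_mul (h : H) (g : G) : s.offset (h * g) * h = s.offset g := by
  have hg : ((h * g : G) : G ⧸ H) = g := by simp
  ext
  simp only [offset, hg, Subgroup.coe_mul]
  group

theorem sigma_mul_offset_mul (g k : G) :
    s.sigma g k * s.offset (g * k) = s.offset g * s.offset k := by
  ext
  simp only [offset, sigma, Subgroup.coe_mul, QuotientGroup.mk_mul, mul_inv, mul_assoc,
    inv_mul_cancel_left]
  ac_rfl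

theorem pullback_mk_charCocycle {B : Type*} [CommGroup B] (χ : H →* B) :
    SymCoh.Z2sym.pullback B (QuotientGroup.mk' H) (s.charCocycle χ) =
      SymCoh.coboundary (χ ∘ s.offset) := by
  ext g k
  change χ (s.sigma g k) = χ (s.offset g) * χ (s.offset k) * (χ (s.offset (g * k)))⁻¹
  rw [eq_mul_inv_iff_mul_eq, ← map_mul, ← map_mul, sigma_mul_offset_mul]

end QuotSection

namespace BilinAlg

variable {F : Type*} [Field F] {A : Type*} [AddCommGroup A] [Module F A]
  {m : A →ₗ[F] A →ₗ[F] A}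

theorem centroid_comm (hm : Submodule.map₂ m ⊤ ⊤ = ⊤) {c c' : Module.End F A}
    (hc : c ∈ centroid m) (hc' : c' ∈ centroid m) : c * c' = c' * c := by
  refine LinearMap.eqLocus_eq_top.1 (top_le_iff.1 (hm ▸ Submodule.map₂_le.2 fun x _ y _ => ?_))
  change c (c' (m x y)) = c' (c (m x y))
  rw [(hc' x y).1, (hc _ _).2, (hc x y).2, (hc' _ _).1]

theorem centroid_eq_bot_iff :
    centroid m = ⊥ ↔ ∀ c ∈ centroid m, ∃ r : F, c = r • 1 := by
  simp only [eq_bot_iff, SetLike.le_def, Algebra.mem_bot, Set.mem_range,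
    Algebra.algebraMap_eq_smul_one, eq_comm]

end BilinAlg

namespace GradedAlg

variable {F : Type u} [Field F] {G : Type v} [CommGroup G]

/-! ### Homogeneous components -/

section Homogeneous

variable (A : GradedAlg.{u, v, w} F G) {M : Type*} [AddCommGroup M] [Module F M]

open Classical in
/-- The linear map on `A` determined by its restrictions to the homogeneous components. -/
noncomputable def lift (f : ∀ g, A.comp g →ₗ[F] M) : A.carrier →ₗ[F] M :=
  DirectSum.toModule F G M f ∘ₗ (A.decomp.symm : A.carrier →ₗ[F] _)

theorem lift_of_mem (f : ∀ g, A.comp g →ₗ[F] M) {g : G} {x : A.carrier} (hx : x ∈ A.comp g) :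
    A.lift f x = f g ⟨x, hx⟩ := by
  classical
  rw [lift, LinearMap.comp_apply, LinearEquiv.coe_coe, decomp_symm_of_mem A hx,
    DirectSum.toModule_lof]

variable {A} in
theorem mem_of_comp_le {P : Submodule F A.carrier} (h : ∀ g, A.comp g ≤ P) (x : A.carrier) :
    x ∈ P :=
  (A.iSup_eq_top ▸ iSup_le h : ⊤ ≤ P) trivial

variable {A} in
theorem hom_ext {f₁ f₂ : A.carrier →ₗ[F] M} (h : ∀ g, ∀ x ∈ A.comp g, f₁ x = f₂ x) : f₁ = f₂ :=
  LinearMap.ext (mem_of_comp_le (P := LinearMap.eqLocus f₁ f₂) h)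

/-- The homogeneous components of an element, as a finitely supported function. -/
noncomputable def comps : A.carrier →ₗ[F] G →₀ A.carrier :=
  A.lift fun g => (Finsupp.lsingle g).domRestrict (A.comp g)

variable {A} {B : GradedAlg.{u, v, w₁} F G} {g k : G} {x : A.carrier}

theorem comps_of_mem (hx : x ∈ A.comp g) : A.comps x = Finsupp.single g x :=
  A.lift_of_mem _ hx

theorem comps_self (hx : x ∈ A.comp g) : A.comps x g = x := by
  rw [comps_of_mem hx, Finsupp.single_eq_same]

theorem comps_ne (hx : x ∈ A.comp g) (hk : k ≠ g) : A.comps x k = 0 := by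
  rw [comps_of_mem hx, Finsupp.single_eq_of_ne hk]

theorem comps_mem_of_mem {P : Submodule F A.carrier} (hx : x ∈ A.comp g) (hP : x ∈ P) (k : G) :
    A.comps x k ∈ P := by
  by_cases hk : k = g
  · rwa [hk, comps_self hx]
  · rw [comps_ne hx hk]
    exact zero_mem P

theorem comps_mem (x : A.carrier) (g : G) : A.comps x g ∈ A.comp g := by
  refine mem_of_comp_le (P := (A.comp g).comap (Finsupp.lapply g ∘ₗ A.comps)) (fun k x hx => ?_) x
  by_cases hk : g = k
  · exact comps_mem_of_mem hx (hk ▸ hx) g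
  · simp [comps_ne hx hk]

theorem sum_comps (x : A.carrier) : ((A.comps x).sum fun _ a => a) = x := by
  have h : (Finsupp.lsum F fun _ : G => (LinearMap.id : A.carrier →ₗ[F] A.carrier)) ∘ₗ A.comps =
      LinearMap.id := hom_ext fun g x hx => by
    simp [comps_of_mem hx]
  exact LinearMap.congr_fun h x

theorem comps_injective : Function.Injective A.comps :=
  fun x y h => by rw [← sum_comps x, ← sum_comps y, h]

theorem mem_of_comps_mem {P : Submodule F A.carrier} (h : ∀ g, A.comps x g ∈ P) : x ∈ P := by
  rw [← sum_comps x]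
  exact Submodule.sum_mem _ fun g _ => h g

theorem mem_comp_of_comps_eq_zero (h : ∀ k, k ≠ g → A.comps x k = 0) : x ∈ A.comp g := by
  refine mem_of_comps_mem fun k => ?_
  by_cases hk : k = g
  · exact hk ▸ comps_mem x k
  · exact h k hk ▸ zero_mem _

theorem eq_zero_of_mem_of_mem (hx : x ∈ A.comp g) (hx' : x ∈ A.comp k) (hgk : g ≠ k) : x = 0 := by
  rw [← comps_self hx, comps_ne hx' hgk]

theorem exists_comps_ne_zero (hx : x ≠ 0) : ∃ g, A.comps x g ≠ 0 := by
  by_contra! h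
  exact hx (comps_injective (by rw [map_zero]; exact Finsupp.ext h))

theorem comps_apply_of_degree {z : G} {f : A.carrier →ₗ[F] B.carrier}
    (hf : ∀ g, ∀ x ∈ A.comp g, f x ∈ B.comp (z * g)) (x : A.carrier) (g : G) :
    B.comps (f x) (z * g) = f (A.comps x g) := by
  have h : Finsupp.lapply (z * g) ∘ₗ B.comps ∘ₗ f = f ∘ₗ Finsupp.lapply g ∘ₗ A.comps :=
    hom_ext fun k x hx => by
      simp only [LinearMap.comp_apply, Finsupp.lapply_apply]
      by_cases hk : g = k
      · subst hk
        rw [comps_self hx, comps_self (hf _ _ hx)]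
      · rw [comps_ne hx hk, comps_ne (hf _ _ hx) (by simpa using hk), map_zero]
  exact LinearMap.congr_fun h x

theorem mul_mem_comp {y : A.carrier} (hx : x ∈ A.comp g) (hy : y ∈ A.comp k) :
    A.mul x y ∈ A.comp (g * k) ∧ A.mul y x ∈ A.comp (g * k) :=
  ⟨A.mul_mem _ _ _ _ hx hy, mul_comm k g ▸ A.mul_mem _ _ _ _ hy hx⟩

theorem comps_mul_left (hx : x ∈ A.comp g) (y : A.carrier) (k : G) :
    A.comps (A.mul x y) (g * k) = A.mul x (A.comps y k) :=
  comps_apply_of_degree (f := A.mul x) (fun _ _ hy => (mul_mem_comp hx hy).1) y k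

theorem comps_mul_right (hx : x ∈ A.comp g) (y : A.carrier) (k : G) :
    A.comps (A.mul y x) (g * k) = A.mul (A.comps y k) x :=
  comps_apply_of_degree (f := A.mul.flip x) (fun _ _ hy => (mul_mem_comp hx hy).2) y k

theorem mem_centroid_of_homogeneous {c : Module.End F A.carrier}
    (h : ∀ g k, ∀ x ∈ A.comp g, ∀ y ∈ A.comp k,
      c (A.mul x y) = A.mul (c x) y ∧ c (A.mul x y) = A.mul x (c y)) :
    c ∈ BilinAlg.centroid A.mul := by
  have h_left := A.bilin_ext (A.mul.compr₂ c) (A.mul.compl₁₂ c LinearMap.id)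
    fun g k x hx y hy => (h g k x hx y hy).1
  have h_right := A.bilin_ext (A.mul.compr₂ c) (A.mul.compl₁₂ LinearMap.id c)
    fun g k x hx y hy => (h g k x hx y hy).2
  exact fun x y => ⟨LinearMap.congr_fun₂ h_left x y, LinearMap.congr_fun₂ h_right x y⟩

theorem isGradedCentral_iff :
    A.IsGradedCentral ↔ ∀ c ∈ A.centroidComp 1, ∃ r : F, c = r • 1 := by
  have h_one : Submodule.span F {1} ≤ A.centroidComp 1 := by
    rw [Submodule.span_singleton_le_iff_mem]
    exact ⟨one_mem _, fun g x hx => by rwa [one_mul]⟩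
  rw [IsGradedCentral, ← h_one.ge_iff_eq']
  simp only [SetLike.le_def, Submodule.mem_span_singleton, eq_comm]

end Homogeneous

/-! ### Graded simplicity -/

section Simplicity

variable {A : GradedAlg.{u, v, w} F G} {P : G → Submodule F A.carrier}

variable (A P) in
/-- A family of subspaces `P g` whose traces `P g ⊓ A_g` are the homogeneous components of a graded
ideal. Only the values on homogeneous elements of the matching degree are constrained, so that such
families can be pulled back along maps that are merely defined degree by degree. -/
def IsIdealFamily : Prop :=
  ∀ g k, ∀ a ∈ A.comp g, ∀ x ∈ A.comp k, x ∈ P k → A.mul a x ∈ P (g * k) ∧ A.mul x a ∈ P (g * k)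

variable (P) in
/-- The span of the traces `P g ⊓ A_g`, for a family of subspaces `P g`. -/
noncomputable def gather : Submodule F A.carrier :=
  ⨅ g, (P g).comap (Finsupp.lapply g ∘ₗ A.comps)

theorem mem_gather {x : A.carrier} : x ∈ gather P ↔ ∀ g, A.comps x g ∈ P g :=
  Submodule.mem_iInf _

theorem mem_gather_of_mem {g : G} {x : A.carrier} (hx : x ∈ A.comp g) :
    x ∈ gather P ↔ x ∈ P g := by
  refine mem_gather.trans ⟨fun h => comps_self hx ▸ h g, fun h k => ?_⟩
  by_cases hk : k = g
  · rwa [hk, comps_self hx]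
  · simp [comps_ne hx hk]

theorem comps_mem_gather {x : A.carrier} (hx : x ∈ gather P) (g : G) :
    A.comps x g ∈ gather P :=
  (mem_gather_of_mem (comps_mem x g)).2 (mem_gather.1 hx g)

theorem IsIdealFamily.isGradedIdeal_gather (hP : A.IsIdealFamily P) :
    A.IsGradedIdeal (gather P) := by
  refine ⟨fun a x hx => ?_, le_antisymm (fun x hx => ?_) (iSup_le fun g => inf_le_left)⟩
  · suffices a ∈ (gather P).comap (A.mul.flip x) ⊓ (gather P).comap (A.mul x) from this
    refine mem_of_comp_le (fun g b hb => ?_) a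
    rw [Submodule.mem_inf, Submodule.mem_comap, Submodule.mem_comap, LinearMap.flip_apply,
      mem_gather, mem_gather, ← forall_and]
    intro k
    have h := hP g (g⁻¹ * k) b hb _ (comps_mem x _) (mem_gather.1 hx _)
    rwa [← comps_mul_left hb, ← comps_mul_right hb, mul_inv_cancel_left] at h
  · exact mem_of_comps_mem fun g =>
      Submodule.mem_iSup_of_mem g ⟨comps_mem_gather hx g, comps_mem x g⟩

theorem IsGradedIdeal.comps_mem {I : Submodule F A.carrier} (hI : A.IsGradedIdeal I)
    {x : A.carrier} (hx : x ∈ I) (g : G) : A.comps x g ∈ I := by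
  suffices h : I ≤ I.comap (Finsupp.lapply g ∘ₗ A.comps) from h hx
  conv_lhs => rw [hI.2]
  exact iSup_le fun k x hx => comps_mem_of_mem hx.2 hx.1 g

theorem isGradedSimple_iff : A.IsGradedSimple ↔ Nontrivial A.carrier ∧
    (∀ P : G → Submodule F A.carrier,
      (∀ g k, ∀ x ∈ A.comp g, ∀ y ∈ A.comp k, A.mul x y ∈ P (g * k)) → ∀ k, A.comp k ≤ P k) ∧
    ∀ P, A.IsIdealFamily P → ∀ g, ∀ x ∈ A.comp g, x ∈ P g → x ≠ 0 → ∀ k, A.comp k ≤ P k := by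
  refine and_congr_right fun _ => and_congr ⟨fun h P hP k y hy => ?_, fun h => ?_⟩
    ⟨fun h P hP g x hx hxP hx0 k y hy => ?_, fun h I hI => ?_⟩
  · have h_le : (⊤ : Submodule F A.carrier) ≤ gather P := by
      rw [← h, Submodule.map₂_le]
      intro a _ b _
      have h_zero := A.bilin_ext (A.mul.compr₂ (gather P).mkQ) 0 fun g k x hx y hy => by
        simpa using (mem_gather_of_mem (A.mul_mem g k x y hx hy)).2 (hP g k x hx y hy)
      simpa using LinearMap.congr_fun₂ h_zero a b
    exact (mem_gather_of_mem hy).1 (h_le trivial)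
  · exact Submodule.eq_top_iff'.2 <| mem_of_comp_le <| h (fun _ => Submodule.map₂ A.mul ⊤ ⊤)
      fun g k x _ y _ => Submodule.apply_mem_map₂ _ trivial trivial
  · rcases h _ hP.isGradedIdeal_gather with h_bot | h_top
    · exact absurd ((Submodule.eq_bot_iff _).1 h_bot x ((mem_gather_of_mem hx).2 hxP)) hx0
    · exact (mem_gather_of_mem hy).1 (h_top ▸ Submodule.mem_top)
  · refine or_iff_not_imp_left.2 fun hI0 => Submodule.eq_top_iff'.2 <| mem_of_comp_le fun k => ?_
    obtain ⟨x, hx, hx0⟩ := Submodule.exists_mem_ne_zero_of_ne_bot hI0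
    obtain ⟨g, hg⟩ := exists_comps_ne_zero hx0
    exact h (fun _ => I) (fun _ _ a _ y _ hy => hI.1 a y hy) g _ (GradedAlg.comps_mem x g)
      (hI.comps_mem hx g) hg k

theorem IsGradedSimple.comp_le_of_mul_mem (hA : A.IsGradedSimple)
    (hP : ∀ g k, ∀ x ∈ A.comp g, ∀ y ∈ A.comp k, A.mul x y ∈ P (g * k)) (k : G) :
    A.comp k ≤ P k :=
  (isGradedSimple_iff.1 hA).2.1 P hP k

theorem IsGradedSimple.comp_le_of_isIdealFamily (hA : A.IsGradedSimple) (hP : A.IsIdealFamily P)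
    {g : G} {x : A.carrier} (hx : x ∈ A.comp g) (hxP : x ∈ P g) (hx0 : x ≠ 0) (k : G) :
    A.comp k ≤ P k :=
  (isGradedSimple_iff.1 hA).2.2 P hP g x hx hxP hx0 k

theorem IsGradedSimple.exists_mem_comp_ne_zero (hA : A.IsGradedSimple) :
    ∃ g, ∃ x ∈ A.comp g, x ≠ 0 := by
  have := hA.1
  obtain ⟨x, hx⟩ := exists_ne (0 : A.carrier)
  obtain ⟨g, hg⟩ := exists_comps_ne_zero hx
  exact ⟨g, _, comps_mem x g, hg⟩

theorem IsGradedSimple.exists_mul_ne_zero (hA : A.IsGradedSimple) {g : G} {x : A.carrier}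
    (hx : x ∈ A.comp g) (hx0 : x ≠ 0) :
    ∃ k, ∃ y ∈ A.comp k, A.mul x y ≠ 0 ∨ A.mul y x ≠ 0 := by
  by_contra! h
  let annihilator : Submodule F A.carrier := LinearMap.ker A.mul ⊓ LinearMap.ker A.mul.flip
  have h_ann : ∀ z ∈ annihilator, ∀ y, A.mul z y = 0 ∧ A.mul y z = 0 := fun z hz y =>
    ⟨LinearMap.congr_fun hz.1 y, LinearMap.congr_fun hz.2 y⟩
  have h_mem : x ∈ annihilator :=
    ⟨hom_ext fun k y hy => (h k y hy).1, hom_ext fun k y hy => (h k y hy).2⟩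
  have h_ideal : A.IsIdealFamily fun _ => annihilator := fun g k a _ z _ hz => by
    rw [(h_ann z hz a).1, (h_ann z hz a).2]
    exact ⟨zero_mem _, zero_mem _⟩
  have h_zero : ∀ k, A.comp k ≤ ⊥ := hA.comp_le_of_mul_mem fun g k y hy z _ =>
    (h_ann y (hA.comp_le_of_isIdealFamily h_ideal hx h_mem hx0 g hy) z).1
  exact hx0 (h_zero g hx)

end Simplicity

/-! ### Twisted isomorphisms -/

/-- A graded linear isomorphism `φ` from `A` to `B` with `φ(x) φ(y) = τ(g, k) φ(x y)` for `x ∈ A_g`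
and `y ∈ A_k`, that is, a graded isomorphism from the twist `A^τ` to `B`. -/
structure TwistedEquiv (τ : SymCoh.Z2sym G Fˣ) (A : GradedAlg.{u, v, w₁} F G)
    (B : GradedAlg.{u, v, w₂} F G) where
  toEquiv : A.carrier ≃ₗ[F] B.carrier
  map_mul : ∀ g k, ∀ x ∈ A.comp g, ∀ y ∈ A.comp k,
    B.mul (toEquiv x) (toEquiv y) = (τ.1 g k : F) • toEquiv (A.mul x y)
  map_mem : ∀ g, ∀ x ∈ A.comp g, toEquiv x ∈ B.comp g

namespace TwistedEquiv

variable {A : GradedAlg.{u, v, w} F G} {B : GradedAlg.{u, v, w₁} F G}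
  {C : GradedAlg.{u, v, w₂} F G} {τ τ' : SymCoh.Z2sym G Fˣ} {g k : G}

theorem comps_apply (φ : TwistedEquiv τ A B) (x : A.carrier) (g : G) :
    B.comps (φ.toEquiv x) g = φ.toEquiv (A.comps x g) := by
  simpa only [one_mul, LinearEquiv.coe_coe] using comps_apply_of_degree (z := 1)
    (f := (φ.toEquiv : A.carrier →ₗ[F] B.carrier))
    (by simpa only [one_mul, LinearEquiv.coe_coe] using φ.map_mem) x g

theorem map_comp (φ : TwistedEquiv τ A B) (g : G) :
    (A.comp g).map (φ.toEquiv : A.carrier →ₗ[F] B.carrier) = B.comp g := by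
  refine le_antisymm (Submodule.map_le_iff_le_comap.2 (φ.map_mem g)) fun y hy => ?_
  refine ⟨A.comps (φ.toEquiv.symm y) g, comps_mem _ g, ?_⟩
  rw [LinearEquiv.coe_coe, ← φ.comps_apply, LinearEquiv.apply_symm_apply, comps_self hy]

theorem exists_mem_comp_eq (φ : TwistedEquiv τ A B) {y : B.carrier} (hy : y ∈ B.comp g) :
    ∃ x ∈ A.comp g, φ.toEquiv x = y :=
  (φ.map_comp g).ge hy

/-- The restriction of a twisted isomorphism to the homogeneous components of degree `g`. -/
def compEquiv (φ : TwistedEquiv τ A B) (g : G) : A.comp g ≃ₗ[F] B.comp g :=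
  φ.toEquiv.ofSubmodules _ _ (φ.map_comp g)

/-- The inverse of a `τ`-twisted isomorphism. -/
def symm (φ : TwistedEquiv τ A B) : TwistedEquiv τ⁻¹ B A where
  toEquiv := φ.toEquiv.symm
  map_mul g k x hx y hy := by
    obtain ⟨a, ha, rfl⟩ := φ.exists_mem_comp_eq hx
    obtain ⟨b, hb, rfl⟩ := φ.exists_mem_comp_eq hy
    rw [φ.map_mul g k a ha b hb, map_smul, smul_smul]
    simp
  map_mem g x hx := by
    obtain ⟨a, ha, rfl⟩ := φ.exists_mem_comp_eq hx
    rwa [LinearEquiv.symm_apply_apply]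

/-- The composition of twisted isomorphisms. -/
def trans (φ : TwistedEquiv τ A B) (ψ : TwistedEquiv τ' B C) : TwistedEquiv (τ * τ') A C where
  toEquiv := φ.toEquiv.trans ψ.toEquiv
  map_mul g k x hx y hy := by
    simp only [LinearEquiv.trans_apply]
    rw [ψ.map_mul g k _ (φ.map_mem g x hx) _ (φ.map_mem k y hy), φ.map_mul g k x hx y hy, map_smul,
      smul_smul, mul_comm]
    rfl
  map_mem g x hx := ψ.map_mem g _ (φ.map_mem g x hx)

/-- Transport of a twisted isomorphism along an equality of cocycles. -/
def cast (φ : TwistedEquiv τ A B) (h : τ = τ') : TwistedEquiv τ' A B := h ▸ φ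

/-- A twisted isomorphism assembled from linear isomorphisms of the homogeneous components. -/
noncomputable def ofComponents (e : ∀ g, A.comp g ≃ₗ[F] B.comp g)
    (h : ∀ g k (x : A.comp g) (y : A.comp k), B.mul (e g x) (e k y) =
      (τ.1 g k : F) • (e (g * k) ⟨A.mul x y, A.mul_mem g k x y x.2 y.2⟩ : B.carrier)) :
    TwistedEquiv τ A B where
  toEquiv := LinearEquiv.ofLinearMap
    (A.lift fun g => (B.comp g).subtype ∘ₗ e g) (B.lift fun g => (A.comp g).subtype ∘ₗ (e g).symm)
    (hom_ext fun g y hy => by simp [lift_of_mem _ _ hy, lift_of_mem _ _ ((e g).symm ⟨y, hy⟩).2])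
    (hom_ext fun g x hx => by simp [lift_of_mem _ _ hx, lift_of_mem _ _ (e g ⟨x, hx⟩).2])
  map_mul g k x hx y hy := by
    simpa [lift_of_mem _ _ hx, lift_of_mem _ _ hy, lift_of_mem _ _ (A.mul_mem _ _ _ _ hx hy)]
      using h g k ⟨x, hx⟩ ⟨y, hy⟩
  map_mem g x hx := by simp [lift_of_mem _ _ hx]

variable (A) in
/-- The rescaling of `A_g` by `γ g`. -/
noncomputable def rescale (γ : G → Fˣ) : TwistedEquiv (SymCoh.coboundary γ) A A :=
  ofComponents (fun g => LinearEquiv.smulOfNeZero F _ _ (γ g).ne_zero) fun g k x y => by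
    simp [SymCoh.coboundary, SymCoh.d, smul_smul, mul_comm (γ g : F)]

theorem map_mul_mem_iff (φ : TwistedEquiv τ A B) {S : Submodule F B.carrier} {x y : A.carrier}
    (hx : x ∈ A.comp g) (hy : y ∈ A.comp k) :
    B.mul (φ.toEquiv x) (φ.toEquiv y) ∈ S ↔ φ.toEquiv (A.mul x y) ∈ S := by
  rw [φ.map_mul g k x hx y hy, Submodule.smul_mem_iff _ (τ.1 g k).ne_zero]

theorem isGradedSimple (φ : TwistedEquiv τ A B) (hA : A.IsGradedSimple) : B.IsGradedSimple := by
  have h_le {P : G → Submodule F B.carrier} {k : G}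
      (h : A.comp k ≤ (P k).comap (φ.toEquiv : A.carrier →ₗ[F] B.carrier)) : B.comp k ≤ P k :=
    φ.map_comp k ▸ Submodule.map_le_iff_le_comap.2 h
  rw [isGradedSimple_iff]
  refine ⟨have := hA.1; φ.toEquiv.symm.toEquiv.nontrivial,
    fun P hP k => h_le (hA.comp_le_of_mul_mem
      (P := fun k => (P k).comap (φ.toEquiv : A.carrier →ₗ[F] B.carrier))
      (fun g k x hx y hy => ?_) k),
    fun P hP g y hy hyP hy0 k => ?_⟩
  · exact (φ.map_mul_mem_iff hx hy).1 (hP g k _ (φ.map_mem g x hx) _ (φ.map_mem k y hy))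
  · obtain ⟨x, hx, rfl⟩ := φ.exists_mem_comp_eq hy
    refine h_le (hA.comp_le_of_isIdealFamily
      (P := fun k => (P k).comap (φ.toEquiv : A.carrier →ₗ[F] B.carrier))
      (fun g k a ha b hb hbP => ?_) hx hyP (by rintro rfl; exact hy0 (map_zero _)) k)
    have h := hP g k _ (φ.map_mem g a ha) _ (φ.map_mem k b hb) hbP
    rwa [φ.map_mul_mem_iff ha hb, φ.map_mul_mem_iff hb ha] at h

/-- The transport of an element of degree `g` of the centroid along a twisted isomorphism, which
sends `φ(x)` to `τ(g, k) φ(c(x))` for `x ∈ A_k`. -/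
noncomputable def conj (φ : TwistedEquiv τ A B) (g : G) (c : Module.End F A.carrier) :
    Module.End F B.carrier :=
  (φ.toEquiv : A.carrier →ₗ[F] B.carrier) ∘ₗ c ∘ₗ A.scale (fun k => (τ.1 g k : F)) ∘ₗ
    (φ.toEquiv.symm : B.carrier →ₗ[F] A.carrier)

theorem conj_apply (φ : TwistedEquiv τ A B) (g : G) (c : Module.End F A.carrier)
    {x : A.carrier} (hx : x ∈ A.comp k) :
    φ.conj g c (φ.toEquiv x) = (τ.1 g k : F) • φ.toEquiv (c x) := by
  simp [conj, A.scale_of_mem _ hx]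

theorem conj_smul (φ : TwistedEquiv τ A B) (g : G) (r : F) (c : Module.End F A.carrier) :
    φ.conj g (r • c) = r • φ.conj g c := by
  ext
  simp [conj]

theorem conj_mem (φ : TwistedEquiv τ A B) {c : Module.End F A.carrier}
    (hc : c ∈ A.centroidComp g) : φ.conj g c ∈ B.centroidComp g := by
  refine ⟨mem_centroid_of_homogeneous fun k l a ha b hb => ?_, fun k a ha => ?_⟩
  · obtain ⟨x, hx, rfl⟩ := φ.exists_mem_comp_eq ha
    obtain ⟨y, hy, rfl⟩ := φ.exists_mem_comp_eq hb
    rw [φ.map_mul k l x hx y hy, map_smul, φ.conj_apply g c hx, φ.conj_apply g c hy,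
      φ.conj_apply g c (A.mul_mem _ _ _ _ hx hy), map_smul, LinearMap.map_smul,
      LinearMap.smul_apply, φ.map_mul _ _ _ (hc.2 k x hx) _ hy,
      φ.map_mul _ _ _ hx _ (hc.2 l y hy)]
    simp only [smul_smul, ← Units.val_mul]
    constructor
    · rw [(hc.1 x y).1, mul_comm, ← τ.2.1]
    · rw [(hc.1 x y).2, τ.2.2 k (g * l), mul_comm, τ.2.1, mul_comm k l, τ.2.2 k l]
  · obtain ⟨x, hx, rfl⟩ := φ.exists_mem_comp_eq ha
    rw [φ.conj_apply g c hx]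
    exact Submodule.smul_mem _ _ (φ.map_mem _ _ (hc.2 k x hx))

theorem conj_ne_zero (φ : TwistedEquiv τ A B) {c : Module.End F A.carrier} (hc : c ≠ 0) :
    φ.conj g c ≠ 0 := by
  refine fun h => hc (hom_ext fun k x hx => ?_)
  have h_apply := φ.conj_apply g c hx
  rw [h, LinearMap.zero_apply] at h_apply
  simpa using h_apply.symm

theorem conj_mul_conj (φ : TwistedEquiv τ A B) (c : Module.End F A.carrier)
    {d : Module.End F A.carrier} (hd : d ∈ A.centroidComp k) :
    φ.conj g c * φ.conj k d = (τ.1 g k : F) • φ.conj (g * k) (c * d) := by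
  refine hom_ext fun l y hy => ?_
  obtain ⟨x, hx, rfl⟩ := φ.exists_mem_comp_eq hy
  rw [LinearMap.smul_apply, Module.End.mul_apply, φ.conj_apply k d hx, map_smul,
    φ.conj_apply g c (hd.2 l x hx), φ.conj_apply (g * k) (c * d) hx, Module.End.mul_apply,
    smul_smul, smul_smul, ← Units.val_mul, ← Units.val_mul, τ.2.1, mul_comm]

theorem isGradedCentral (φ : TwistedEquiv τ A B) (hA : A.IsGradedCentral) :
    B.IsGradedCentral := by
  rw [isGradedCentral_iff] at hA ⊢
  intro c hc
  obtain ⟨r, hr⟩ := hA _ (φ.symm.conj_mem hc)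
  refine ⟨(τ⁻¹.1 1 1 : F)⁻¹ * r, hom_ext fun k x hx => φ.symm.toEquiv.injective ?_⟩
  have h_apply := φ.symm.conj_apply 1 c hx
  rw [hr, SymCoh.Z2sym.apply_one_left, ← inv_smul_eq_iff₀ (Units.ne_zero _)] at h_apply
  rw [← h_apply, mul_smul]
  simp only [LinearMap.smul_apply, Module.End.one_apply, map_smul]

theorem isGradedCentralSimple (φ : TwistedEquiv τ A B) (hA : A.IsGradedCentralSimple) :
    B.IsGradedCentralSimple :=
  ⟨φ.isGradedSimple hA.1, φ.isGradedCentral hA.2⟩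

end TwistedEquiv

theorem iso_twist_iff_nonempty (A B : GradedAlg.{u, v, w} F G) (τ : SymCoh.Z2sym G Fˣ) :
    Iso (A.twist τ) B ↔ Nonempty (TwistedEquiv τ A B) := by
  rw [iso_twist_iff]
  constructor
  · rintro ⟨φ, hm, hc⟩
    exact ⟨φ, fun g k x hx y hy => (hm g k x hx y hy).symm,
      fun g x hx => hc g ▸ Submodule.mem_map_of_mem hx⟩
  · rintro ⟨φ⟩
    exact ⟨φ.toEquiv, fun g k x hx y hy => (φ.map_mul g k x hx y hy).symm, φ.map_comp⟩

theorem nonempty_twistedEquiv_twist (A : GradedAlg.{u, v, w} F G) (τ : SymCoh.Z2sym G Fˣ) :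
    Nonempty (TwistedEquiv τ A (A.twist τ)) :=
  (iso_twist_iff_nonempty A _ τ).1 (Iso.refl _)

theorem iso_twist_twist_iff (A B : GradedAlg.{u, v, w} F G) (τ τ' : SymCoh.Z2sym G Fˣ) :
    Iso (A.twist τ) (B.twist τ') ↔ Nonempty (TwistedEquiv (τ * τ'⁻¹) A B) := by
  obtain ⟨ι⟩ := nonempty_twistedEquiv_twist B τ'
  rw [iso_twist_iff_nonempty]
  exact ⟨fun ⟨φ⟩ => ⟨φ.trans ι.symm⟩, fun ⟨φ⟩ => ⟨(φ.trans ι).cast (inv_mul_cancel_right _ _)⟩⟩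

/-! ### Homogeneous elements of the centroid -/

section Centroid

variable {A : GradedAlg.{u, v, w} F G} {g k : G} {c d : Module.End F A.carrier}

theorem mul_mem_centroidComp (hc : c ∈ A.centroidComp g) (hd : d ∈ A.centroidComp k) :
    c * d ∈ A.centroidComp (g * k) :=
  ⟨Subalgebra.mul_mem _ hc.1 hd.1, fun l x hx => mul_assoc g k l ▸ hc.2 _ _ (hd.2 l x hx)⟩

theorem one_mem_centroidComp_one : (1 : Module.End F A.carrier) ∈ A.centroidComp 1 :=
  ⟨one_mem _, fun k x hx => by rwa [one_mul]⟩

theorem comps_apply_of_mem_centroidComp (hc : c ∈ A.centroidComp g) (x : A.carrier) (k : G) :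
    A.comps (c x) (g * k) = c (A.comps x k) :=
  comps_apply_of_degree hc.2 x k

theorem IsGradedSimple.bijective_of_mem_centroidComp (hA : A.IsGradedSimple)
    (hc : c ∈ A.centroidComp g) (hc0 : c ≠ 0) : Function.Bijective c := by
  have h_ker : A.IsIdealFamily fun _ => LinearMap.ker c := fun _ _ a _ x _ hx => by
    simp only [LinearMap.mem_ker] at hx ⊢
    rw [(hc.1 a x).2, (hc.1 x a).1, hx, map_zero, map_zero, LinearMap.zero_apply]
    exact ⟨rfl, rfl⟩
  have h_range : A.IsIdealFamily fun _ => LinearMap.range c := by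
    rintro _ _ a _ _ _ ⟨x, rfl⟩
    exact ⟨⟨_, (hc.1 a x).2⟩, ⟨_, (hc.1 x a).1⟩⟩
  constructor
  · rw [injective_iff_map_eq_zero]
    intro x hx
    by_contra hx0
    obtain ⟨k, hk⟩ := exists_comps_ne_zero hx0
    have h_comp : c (A.comps x k) = 0 := by simp [← comps_apply_of_mem_centroidComp hc, hx]
    exact hc0 (hom_ext (hA.comp_le_of_isIdealFamily h_ker (comps_mem x k) h_comp hk))
  · obtain ⟨k, x, hx, hcx⟩ : ∃ k, ∃ x ∈ A.comp k, c x ≠ 0 := by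
      by_contra! h
      exact hc0 (hom_ext h)
    exact mem_of_comp_le (P := LinearMap.range c)
      (hA.comp_le_of_isIdealFamily h_range (hc.2 k x hx) ⟨x, rfl⟩ hcx)

theorem IsGradedSimple.mul_ne_zero_of_mem_centroidComp (hA : A.IsGradedSimple)
    (hc : c ∈ A.centroidComp g) (hc0 : c ≠ 0) (hd0 : d ≠ 0) : c * d ≠ 0 := fun h =>
  hd0 (LinearMap.ext fun x => (hA.bijective_of_mem_centroidComp hc hc0).1 <| by
    simpa using LinearMap.congr_fun h x)

theorem IsGradedSimple.exists_mul_eq_one (hA : A.IsGradedSimple) (hc : c ∈ A.centroidComp g)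
    (hc0 : c ≠ 0) : ∃ d ∈ A.centroidComp g⁻¹, d * c = 1 ∧ c * d = 1 := by
  let e := LinearEquiv.ofBijective c (hA.bijective_of_mem_centroidComp hc hc0)
  have he (x) : c (e.symm x) = x := e.apply_symm_apply x
  refine ⟨e.symm, ⟨fun x y => ⟨e.injective ?_, e.injective ?_⟩, fun k x hx => ?_⟩,
    LinearMap.ext e.symm_apply_apply, LinearMap.ext he⟩
  · change c (e.symm _) = c (A.mul (e.symm x) y)
    rw [he, (hc.1 _ _).1, he]
  · change c (e.symm _) = c (A.mul x (e.symm y))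
    rw [he, (hc.1 _ _).2, he]
  · refine mem_comp_of_comps_eq_zero fun l hl => e.injective ?_
    change c (A.comps (e.symm x) l) = c 0
    rw [← comps_apply_of_mem_centroidComp hc, he, map_zero,
      comps_ne hx fun h => hl (eq_inv_mul_of_mul_eq h)]

/-- The subgroup of the `g` for which the centroid has a nonzero element of degree `g`. -/
def centroidSupport (hA : A.IsGradedSimple) : Subgroup G where
  carrier := {g | ∃ c ∈ A.centroidComp g, c ≠ 0}
  one_mem' := have := hA.1; ⟨1, one_mem_centroidComp_one, one_ne_zero⟩
  mul_mem' := by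
    rintro g k ⟨c, hc, hc0⟩ ⟨d, hd, hd0⟩
    exact ⟨c * d, mul_mem_centroidComp hc hd, hA.mul_ne_zero_of_mem_centroidComp hc hc0 hd0⟩
  inv_mem' := by
    rintro g ⟨c, hc, hc0⟩
    have := hA.1
    obtain ⟨d, hd, -, hcd⟩ := hA.exists_mul_eq_one hc hc0
    exact ⟨d, hd, right_ne_zero_of_mul (hcd ▸ one_ne_zero)⟩

theorem TwistedEquiv.centroidSupport_eq {B : GradedAlg.{u, v, w₁} F G} {τ : SymCoh.Z2sym G Fˣ}
    (φ : TwistedEquiv τ A B) (hA : A.IsGradedSimple) (hB : B.IsGradedSimple) :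
    centroidSupport hA = centroidSupport hB :=
  Subgroup.ext fun _ => ⟨fun ⟨_, hc, hc0⟩ => ⟨_, φ.conj_mem hc, φ.conj_ne_zero hc0⟩,
    fun ⟨_, hc, hc0⟩ => ⟨_, φ.symm.conj_mem hc, φ.symm.conj_ne_zero hc0⟩⟩

theorem IsGradedCentralSimple.exists_eq_smul (hA : A.IsGradedCentralSimple)
    (hc : c ∈ A.centroidComp g) (hc0 : c ≠ 0) (hd : d ∈ A.centroidComp g) (hd0 : d ≠ 0) :
    ∃ r : Fˣ, d = (r : F) • c := by
  obtain ⟨c', hc', -, hcc'⟩ := hA.1.exists_mul_eq_one hc hc0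
  have h_one : c' * d ∈ A.centroidComp 1 := inv_mul_cancel g ▸ mul_mem_centroidComp hc' hd
  obtain ⟨r, hr⟩ := isGradedCentral_iff.1 hA.2 _ h_one
  have h_eq : d = r • c := by
    calc d = c * (c' * d) := by rw [← mul_assoc, hcc', one_mul]
      _ = r • c := by rw [hr, mul_smul_comm, mul_one]
  exact ⟨Units.mk0 r (left_ne_zero_of_smul (h_eq ▸ hd0)), h_eq⟩

end Centroid

/-- A family of nonzero homogeneous elements `X h` of the centroid, one in each degree `h ∈ H`, with
`X h * X k = σ(h, k) • X (h k)`. Such a family spans a copy of the twisted group algebra `F^σ H`. -/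
structure CentralFrame (B : GradedAlg.{u, v, w} F G) (H : Subgroup G)
    (σ : SymCoh.Z2sym H Fˣ) where
  toFun : H → Module.End F B.carrier
  mem : ∀ h : H, toFun h ∈ B.centroidComp h
  ne_zero : ∀ h, toFun h ≠ 0
  mul : ∀ h k, toFun h * toFun k = (σ.1 h k : F) • toFun (h * k)

namespace CentralFrame

variable {A : GradedAlg.{u, v, w₁} F G} {B : GradedAlg.{u, v, w} F G} {H : Subgroup G}
  {σ σ' : SymCoh.Z2sym H Fˣ}

/-- The image of a central frame under a twisted isomorphism. -/
noncomputable def conj {τ : SymCoh.Z2sym G Fˣ} (X : CentralFrame A H σ) (φ : TwistedEquiv τ A B) :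
    CentralFrame B H (SymCoh.Z2sym.pullback Fˣ H.subtype τ * σ) where
  toFun h := φ.conj h (X.toFun h)
  mem h := φ.conj_mem (X.mem h)
  ne_zero h := φ.conj_ne_zero (X.ne_zero h)
  mul h k := by
    rw [φ.conj_mul_conj _ (X.mem k), X.mul, φ.conj_smul, smul_smul]
    rfl

/-- The central frame obtained by rescaling `X h` by `γ h`. -/
def rescale (X : CentralFrame B H σ) (γ : H → Fˣ) :
    CentralFrame B H (σ * SymCoh.coboundary γ) where
  toFun h := (γ h : F) • X.toFun h
  mem h := Submodule.smul_mem _ _ (X.mem h)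
  ne_zero h := smul_ne_zero (γ h).ne_zero (X.ne_zero h)
  mul h k := by
    have h_coeff : γ h * γ k * σ.1 h k =
        (σ * SymCoh.coboundary γ).1 h k * γ (h * k) := by
      rw [mul_comm, ← SymCoh.coboundary_apply_mul, ← mul_assoc]
      rfl
    rw [smul_mul_smul_comm, X.mul, smul_smul, smul_smul]
    exact congrArg (fun u : Fˣ => (u : F) • X.toFun (h * k)) h_coeff

/-- Transport of a central frame along an equality of cocycles. -/
def cast (X : CentralFrame B H σ) (h : σ = σ') : CentralFrame B H σ' := h ▸ X

theorem exists_eq_smul (hB : B.IsGradedCentralSimple) (X : CentralFrame B H σ)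
    (X' : CentralFrame B H σ') :
    ∃ γ : H → Fˣ, (∀ h : H, X'.toFun h = (γ h : F) • X.toFun h) ∧
      σ' = σ * SymCoh.coboundary γ := by
  choose γ hγ using fun h : H =>
    hB.exists_eq_smul (X.mem h) (X.ne_zero h) (X'.mem h) (X'.ne_zero h)
  refine ⟨γ, hγ, Subtype.ext (funext₂ fun h k => mul_right_cancel (b := γ (h * k)) ?_)⟩
  have h_mul : (σ'.1 h k * γ (h * k) : F) = γ h * γ k * σ.1 h k := by
    refine smul_left_injective F (X.ne_zero (h * k)) ?_
    calc (σ'.1 h k * γ (h * k) : F) • X.toFun (h * k)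
        = X'.toFun h * X'.toFun k := by rw [X'.mul, hγ, mul_smul]
      _ = (γ h * γ k * σ.1 h k : F) • X.toFun (h * k) := by
        rw [hγ h, hγ k, smul_mul_smul_comm, X.mul, smul_smul]
  calc σ'.1 h k * γ (h * k) = γ h * γ k * σ.1 h k := Units.ext h_mul
    _ = (σ * SymCoh.coboundary γ).1 h k * γ (h * k) := by
      rw [mul_comm, ← SymCoh.coboundary_apply_mul, ← mul_assoc]
      rfl

theorem exists_centroidSupport (hB : B.IsGradedCentralSimple) :
    ∃ σ, Nonempty (CentralFrame B (centroidSupport hB.1) σ) := by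
  choose X hX hX0 using fun h : centroidSupport hB.1 => h.2
  choose σ hσ using fun h k : centroidSupport hB.1 =>
    hB.exists_eq_smul (hX (h * k)) (hX0 (h * k)) (mul_mem_centroidComp (hX h) (hX k))
      (hB.1.mul_ne_zero_of_mem_centroidComp (hX h) (hX0 h) (hX0 k))
  have h_assoc (h k l) : σ h k * σ (h * k) l = σ h (k * l) * σ k l := by
    refine Units.ext (smul_left_injective F (hX0 (h * k * l)) ?_)
    calc (σ h k * σ (h * k) l : F) • X (h * k * l)
        = X h * X k * X l := by rw [hσ h k, smul_mul_assoc, hσ, smul_smul]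
      _ = (σ h (k * l) * σ k l : F) • X (h * k * l) := by
        rw [mul_assoc, hσ k l, mul_smul_comm, hσ, smul_smul, mul_assoc h, mul_comm (σ k l : F)]
  have h_comm (h k) : σ h k = σ k h := by
    refine Units.ext (smul_left_injective F (hX0 (h * k)) ?_)
    change (σ h k : F) • X (h * k) = (σ k h : F) • X (h * k)
    rw [← hσ, mul_comm h k, ← hσ, BilinAlg.centroid_comm hB.1.2.1 (hX h).1 (hX k).1]
  exact ⟨⟨σ, h_assoc, h_comm⟩, ⟨⟨X, hX, hX0, hσ⟩⟩⟩

theorem map_one (hB : B.IsGradedSimple) (X : CentralFrame B H 1) : X.toFun 1 = 1 := by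
  have h_mul : X.toFun 1 * X.toFun 1 = X.toFun 1 := by
    rw [X.mul, mul_one]
    exact one_smul F _
  exact LinearMap.ext fun x =>
    (hB.bijective_of_mem_centroidComp (X.mem 1) (X.ne_zero 1)).1 (LinearMap.congr_fun h_mul x)

/-- A central frame with trivial cocycle, as a representation of `H`. -/
def toMonoidHom (hB : B.IsGradedSimple) (X : CentralFrame B H 1) :
    H →* Module.End F B.carrier where
  toFun := X.toFun
  map_one' := X.map_one hB
  map_mul' h k := by rw [X.mul]; exact (one_smul F _).symm

end CentralFrame

/-! ### Loop algebras -/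

section Loop

variable {H : Subgroup G} (A : GradedAlg.{u, v, w} F (G ⧸ H))

/-- The linear map `a ↦ a_{π(k)} ⊗ k` into the loop algebra. -/
noncomputable def toLoop (k : G) : A.carrier →ₗ[F] A.loop.carrier :=
  LinearMap.codRestrict A.loopSubmodule
    (Finsupp.lsingle k ∘ₗ Finsupp.lapply (QuotientGroup.mk k : G ⧸ H) ∘ₗ A.comps)
    fun a => A.single_mem_loop (comps_mem a _)

/-- The algebra homomorphism `a ⊗ k ↦ a` from the loop algebra. -/
noncomputable def ofLoop : A.loop.carrier →ₗ[F] A.carrier :=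
  (Finsupp.lsum F fun _ : G => (LinearMap.id : A.carrier →ₗ[F] A.carrier)) ∘ₗ
    A.loopSubmodule.subtype

theorem toLoop_mem (k : G) (a : A.carrier) : A.toLoop k a ∈ A.loop.comp k :=
  fun _ hl => Finsupp.single_eq_of_ne hl

variable {A} {g k l : G} {z : G ⧸ H} {a b : A.carrier} {x y : A.loop.carrier}

theorem coe_toLoop (ha : a ∈ A.comp k) : (A.toLoop k a).1 = Finsupp.single k a :=
  congrArg (Finsupp.single k) (comps_self ha)

theorem ofLoop_of_mem (hx : x ∈ A.loop.comp k) : A.ofLoop x = x.1 k := by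
  change Finsupp.lsum F (fun _ : G => (LinearMap.id : A.carrier →ₗ[F] A.carrier)) x.1 = _
  rw [A.loopComp_eq_single hx]
  simp

theorem ofLoop_mem (hx : x ∈ A.loop.comp k) : A.ofLoop x ∈ A.comp k :=
  ofLoop_of_mem hx ▸ x.2 k

theorem ofLoop_toLoop (ha : a ∈ A.comp k) : A.ofLoop (A.toLoop k a) = a := by
  rw [ofLoop_of_mem (A.toLoop_mem k a), coe_toLoop ha, Finsupp.single_eq_same]

theorem toLoop_ofLoop (hx : x ∈ A.loop.comp k) : A.toLoop k (A.ofLoop x) = x := by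
  refine Subtype.ext ?_
  rw [coe_toLoop (ofLoop_mem hx), ofLoop_of_mem hx, A.loopComp_eq_single hx,
    Finsupp.single_eq_same]

theorem ofLoop_surjective : Function.Surjective A.ofLoop :=
  mem_of_comp_le (P := LinearMap.range A.ofLoop) fun z a ha => by
    obtain ⟨k, rfl⟩ := QuotientGroup.mk_surjective z
    exact ⟨_, ofLoop_toLoop ha⟩

theorem eq_of_ofLoop_eq (hx : x ∈ A.loop.comp k) (hy : y ∈ A.loop.comp k)
    (h : A.ofLoop x = A.ofLoop y) : x = y := by
  rw [← toLoop_ofLoop hx, h, toLoop_ofLoop hy]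

theorem eq_zero_of_ofLoop_eq_zero (hx : x ∈ A.loop.comp k) (h : A.ofLoop x = 0) : x = 0 :=
  eq_of_ofLoop_eq hx (zero_mem _) (h.trans (map_zero _).symm)

theorem loop_mul_toLoop (ha : a ∈ A.comp k) (hb : b ∈ A.comp l) :
    A.loop.mul (A.toLoop k a) (A.toLoop l b) = A.toLoop (k * l) (A.mul a b) := by
  refine Subtype.ext ?_
  change groupAlgMul A.mul (A.toLoop k a).1 (A.toLoop l b).1 = _
  rw [coe_toLoop ha, coe_toLoop hb, coe_toLoop (A.mul_mem _ _ _ _ ha hb), groupAlgMul_single]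

theorem ofLoop_mul (x y : A.loop.carrier) :
    A.ofLoop (A.loop.mul x y) = A.mul (A.ofLoop x) (A.ofLoop y) := by
  have h := A.loop.bilin_ext (A.loop.mul.compr₂ A.ofLoop) (A.mul.compl₁₂ A.ofLoop A.ofLoop)
    fun k l x hx y hy => by
      have hx' := ofLoop_mem hx
      have hy' := ofLoop_mem hy
      rw [LinearMap.compr₂_apply, LinearMap.compl₁₂_apply, ← toLoop_ofLoop hx,
        ← toLoop_ofLoop hy, loop_mul_toLoop hx' hy', ofLoop_toLoop (A.mul_mem _ _ _ _ hx' hy'),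
        ofLoop_toLoop hx', ofLoop_toLoop hy']
  exact LinearMap.congr_fun₂ h x y

variable (A) in
/-- The isomorphism `a ⊗ g ↦ a` from a component of the loop algebra to the component of `A` whose
degree is the image of `g`. -/
noncomputable def loopCompEquiv (h : (g : G ⧸ H) = z) : A.loop.comp g ≃ₗ[F] A.comp z :=
  LinearEquiv.ofLinearMap (A.ofLoop.restrict fun _ hx => h ▸ ofLoop_mem hx)
    ((A.toLoop g).restrict fun a _ => A.toLoop_mem g a)
    (LinearMap.ext fun a => Subtype.ext (ofLoop_toLoop (h ▸ a.2)))
    (LinearMap.ext fun x => Subtype.ext (toLoop_ofLoop x.2))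

/-- The elements `a` with `a ⊗ k ∈ P k` for all `k` in the coset `z`. -/
noncomputable def descend (P : G → Submodule F A.loop.carrier) (z : G ⧸ H) :
    Submodule F A.carrier :=
  ⨅ k : {k : G // (k : G ⧸ H) = z}, (P k).comap (A.toLoop k)

theorem mem_descend {P : G → Submodule F A.loop.carrier} :
    a ∈ descend P z ↔ ∀ k : G, (k : G ⧸ H) = z → A.toLoop k a ∈ P k := by
  simp [descend, Submodule.mem_iInf]

theorem mul_mem_descend {P : G → Submodule F A.loop.carrier} (ha : a ∈ A.comp l)
    (hb : b ∈ A.comp z) (h : ∀ k : G, (k : G ⧸ H) = z →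
      A.loop.mul (A.toLoop l a) (A.toLoop k b) ∈ P (l * k) ∧
      A.loop.mul (A.toLoop k b) (A.toLoop l a) ∈ P (l * k)) :
    A.mul a b ∈ descend P (l * z) ∧ A.mul b a ∈ descend P (l * z) := by
  rw [mem_descend, mem_descend, ← forall_and]
  refine fun k => ?_
  obtain ⟨k, rfl⟩ : ∃ k', l * k' = k := ⟨l⁻¹ * k, mul_inv_cancel_left l k⟩
  rw [← imp_and, QuotientGroup.mk_mul, mul_right_inj]
  rintro rfl
  rw [← loop_mul_toLoop ha hb, mul_comm l k, ← loop_mul_toLoop hb ha, mul_comm k l]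
  exact h k rfl

theorem IsIdealFamily.descend {P : G → Submodule F A.loop.carrier} (hP : A.loop.IsIdealFamily P) :
    A.IsIdealFamily (descend P) := by
  intro y z a ha b hb hbP
  obtain ⟨l, rfl⟩ := QuotientGroup.mk_surjective y
  exact mul_mem_descend ha hb fun k hk =>
    hP l k _ (A.toLoop_mem l a) _ (A.toLoop_mem k b) (mem_descend.1 hbP k hk)

theorem comp_le_of_comp_le_descend {P : G → Submodule F A.loop.carrier}
    (h : A.comp k ≤ descend P k) : A.loop.comp k ≤ P k := fun _ hx =>
  toLoop_ofLoop hx ▸ mem_descend.1 (h (ofLoop_mem hx)) k rfl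

theorem IsGradedSimple.loop (hA : A.IsGradedSimple) : A.loop.IsGradedSimple := by
  refine isGradedSimple_iff.2 ⟨?_, fun P hP k => ?_, fun P hP l x hx hxP hx0 k => ?_⟩
  · obtain ⟨z, a, ha, ha0⟩ := hA.exists_mem_comp_ne_zero
    obtain ⟨k, rfl⟩ := QuotientGroup.mk_surjective z
    exact ⟨A.toLoop k a, 0, fun h => ha0 (by rw [← ofLoop_toLoop ha, h, map_zero])⟩
  · refine comp_le_of_comp_le_descend (hA.comp_le_of_mul_mem (fun y z a ha b hb => ?_) k)
    obtain ⟨l, rfl⟩ := QuotientGroup.mk_surjective y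
    exact (mul_mem_descend ha hb fun m _ => ⟨hP l m _ (A.toLoop_mem l a) _ (A.toLoop_mem m b),
      mul_comm l m ▸ hP m l _ (A.toLoop_mem m b) _ (A.toLoop_mem l a)⟩).1
  · have h_mul {z : G ⧸ H} {b : A.carrier} (hb : b ∈ A.comp z) :
        A.mul (A.ofLoop x) b ∈ descend P (l * z) ∧ A.mul b (A.ofLoop x) ∈ descend P (l * z) :=
      mul_mem_descend (ofLoop_mem hx) hb fun m _ => by
        have h := hP m l _ (A.toLoop_mem m b) x hx hxP
        rwa [toLoop_ofLoop hx, and_comm, mul_comm l m]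
    have h_le {y : G ⧸ H} {d : A.carrier} (hd : d ∈ A.comp y) (hdP : d ∈ descend P y)
        (hd0 : d ≠ 0) : A.loop.comp k ≤ P k :=
      comp_le_of_comp_le_descend (hA.comp_le_of_isIdealFamily hP.descend hd hdP hd0 k)
    obtain ⟨z, b, hb, hab | hba⟩ := hA.exists_mul_ne_zero (ofLoop_mem hx)
      (mt (eq_zero_of_ofLoop_eq_zero hx) hx0)
    · exact h_le (mul_mem_comp (ofLoop_mem hx) hb).1 (h_mul hb).1 hab
    · exact h_le (mul_mem_comp (ofLoop_mem hx) hb).2 (h_mul hb).2 hba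

theorem IsGradedSimple.of_loop (hL : A.loop.IsGradedSimple) : A.IsGradedSimple := by
  have h_le {P : G ⧸ H → Submodule F A.carrier}
      (h : ∀ k, A.loop.comp k ≤ (P k).comap A.ofLoop) (z : G ⧸ H) : A.comp z ≤ P z := by
    obtain ⟨k, rfl⟩ := QuotientGroup.mk_surjective z
    exact fun a ha => ofLoop_toLoop ha ▸ h k (A.toLoop_mem k a)
  refine isGradedSimple_iff.2 ⟨?_, fun P hP => h_le fun k => ?_, fun P hP z a ha haP ha0 =>
    h_le ?_⟩
  · obtain ⟨k, x, hx, hx0⟩ := hL.exists_mem_comp_ne_zero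
    exact ⟨A.ofLoop x, 0, mt (eq_zero_of_ofLoop_eq_zero hx) hx0⟩
  · refine hL.comp_le_of_mul_mem (P := fun k : G => (P k).comap A.ofLoop)
      (fun k l x hx y hy => ?_) k
    rw [Submodule.mem_comap, ofLoop_mul]
    exact hP k l _ (ofLoop_mem hx) _ (ofLoop_mem hy)
  · obtain ⟨k, rfl⟩ := QuotientGroup.mk_surjective z
    refine hL.comp_le_of_isIdealFamily (P := fun k : G => (P k).comap A.ofLoop)
      (fun l m b hb x hx hxP => ?_) (A.toLoop_mem k a)
      (by rwa [Submodule.mem_comap, ofLoop_toLoop ha])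
      (fun h => ha0 (by rw [← ofLoop_toLoop ha, h, map_zero]))
    rw [Submodule.mem_comap, Submodule.mem_comap, ofLoop_mul, ofLoop_mul]
    exact hP l m _ (ofLoop_mem hb) _ (ofLoop_mem hx) hxP

variable (A) in
/-- The shift `a ⊗ k ↦ f(a) ⊗ g k` of the loop algebra, for `f` homogeneous of degree `π(g)`. -/
noncomputable def loopShift (g : G) (f : Module.End F A.carrier) : Module.End F A.loop.carrier :=
  A.loop.lift fun k => (A.toLoop (g * k) ∘ₗ f ∘ₗ A.ofLoop).domRestrict (A.loop.comp k)

theorem loopShift_of_mem (f : Module.End F A.carrier) (hx : x ∈ A.loop.comp k) :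
    A.loopShift g f x = A.toLoop (g * k) (f (A.ofLoop x)) :=
  A.loop.lift_of_mem _ hx

theorem loopShift_mem (f : Module.End F A.carrier) (hx : x ∈ A.loop.comp k) :
    A.loopShift g f x ∈ A.loop.comp (g * k) :=
  loopShift_of_mem f hx ▸ A.toLoop_mem _ _

theorem ofLoop_loopShift {f : Module.End F A.carrier} (hf : f ∈ A.centroidComp g)
    (x : A.loop.carrier) : A.ofLoop (A.loopShift g f x) = f (A.ofLoop x) := by
  have h : A.ofLoop ∘ₗ A.loopShift g f = f ∘ₗ A.ofLoop := hom_ext fun k x hx => by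
    rw [LinearMap.comp_apply, LinearMap.comp_apply, loopShift_of_mem f hx,
      ofLoop_toLoop (hf.2 _ _ (ofLoop_mem hx))]
  exact LinearMap.congr_fun h x

theorem loopShift_mem_centroidComp {f : Module.End F A.carrier} (hf : f ∈ A.centroidComp g) :
    A.loopShift g f ∈ A.loop.centroidComp g := by
  refine ⟨mem_centroid_of_homogeneous fun k l x hx y hy => ?_, fun k x => loopShift_mem f⟩
  have h_mem := loopShift_mem (g := g) f (A.loop.mul_mem _ _ _ _ hx hy)
  constructor
  · refine eq_of_ofLoop_eq h_mem
      (mul_assoc g k l ▸ A.loop.mul_mem _ _ _ _ (loopShift_mem f hx) hy) ?_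
    rw [ofLoop_loopShift hf, ofLoop_mul, ofLoop_mul, ofLoop_loopShift hf, (hf.1 _ _).1]
  · refine eq_of_ofLoop_eq h_mem
      (mul_left_comm g k l ▸ A.loop.mul_mem _ _ _ _ hx (loopShift_mem f hy)) ?_
    rw [ofLoop_loopShift hf, ofLoop_mul, ofLoop_mul, ofLoop_loopShift hf, (hf.1 _ _).2]

theorem loopShift_ne_zero {f : Module.End F A.carrier} (hf : f ∈ A.centroidComp g) (hf0 : f ≠ 0) :
    A.loopShift g f ≠ 0 := by
  refine fun h => hf0 ((LinearMap.cancel_right ofLoop_surjective).1 (LinearMap.ext fun x => ?_))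
  rw [LinearMap.comp_apply, ← ofLoop_loopShift hf, h, LinearMap.zero_apply, map_zero,
    LinearMap.zero_comp, LinearMap.zero_apply]

end Loop

section LoopCentroid

variable {H : Subgroup G} {A : GradedAlg.{u, v, w} F (G ⧸ H)} {g k l : G}

theorem IsGradedSimple.ofLoop_centroid_toLoop (hA : A.IsGradedSimple)
    {c : Module.End F A.loop.carrier} (hc : c ∈ BilinAlg.centroid A.loop.mul) {a : A.carrier}
    (ha : a ∈ A.comp k) (hkl : (k : G ⧸ H) = l) :
    A.ofLoop (c (A.toLoop k a)) = A.ofLoop (c (A.toLoop l a)) := by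
  let P (z : G ⧸ H) : Submodule F A.carrier := ⨅ _ : z = k,
    LinearMap.eqLocus (A.ofLoop ∘ₗ c ∘ₗ A.toLoop k) (A.ofLoop ∘ₗ c ∘ₗ A.toLoop l)
  suffices h : A.comp k ≤ P k from (Submodule.mem_iInf _).1 (h ha) rfl
  refine hA.comp_le_of_mul_mem (fun y z b hb d hd => (Submodule.mem_iInf _).2 fun h => ?_) k
  obtain ⟨m, rfl⟩ := QuotientGroup.mk_surjective y
  obtain ⟨k, rfl⟩ : ∃ k', m * k' = k := ⟨m⁻¹ * k, mul_inv_cancel_left m k⟩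
  obtain ⟨l, rfl⟩ : ∃ l', m * l' = l := ⟨m⁻¹ * l, mul_inv_cancel_left m l⟩
  rw [QuotientGroup.mk_mul, mul_right_inj] at h
  rw [QuotientGroup.mk_mul, QuotientGroup.mk_mul, mul_right_inj] at hkl
  subst h
  change A.ofLoop (c (A.toLoop (m * k) _)) = A.ofLoop (c (A.toLoop (m * l) _))
  rw [← loop_mul_toLoop hb hd, ← loop_mul_toLoop hb (hkl ▸ hd), (hc _ _).1, (hc _ _).1,
    ofLoop_mul, ofLoop_mul, ofLoop_toLoop hd, ofLoop_toLoop (hkl ▸ hd)]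

theorem IsGradedSimple.exists_eq_loopShift (hA : A.IsGradedSimple)
    {c : Module.End F A.loop.carrier} (hc : c ∈ A.loop.centroidComp g) :
    ∃ f ∈ A.centroidComp g, c = A.loopShift g f := by
  let f : Module.End F A.carrier :=
    A.lift fun z => (A.ofLoop ∘ₗ c ∘ₗ A.toLoop z.out).domRestrict (A.comp z)
  have hf {k : G} {a : A.carrier} (ha : a ∈ A.comp k) : f a = A.ofLoop (c (A.toLoop k a)) :=
    (A.lift_of_mem _ ha).trans
      (hA.ofLoop_centroid_toLoop hc.1 ha (Quotient.out_eq (k : G ⧸ H)).symm).symm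
  refine ⟨f, ⟨mem_centroid_of_homogeneous fun y z a ha b hb => ?_, fun z a ha => ?_⟩,
    hom_ext fun k x hx => ?_⟩
  · obtain ⟨k, rfl⟩ := QuotientGroup.mk_surjective y
    obtain ⟨l, rfl⟩ := QuotientGroup.mk_surjective z
    rw [hf ha, hf hb, hf (A.mul_mem _ _ _ _ ha hb), ← loop_mul_toLoop ha hb]
    constructor
    · rw [(hc.1 _ _).1, ofLoop_mul, ofLoop_toLoop hb]
    · rw [(hc.1 _ _).2, ofLoop_mul, ofLoop_toLoop ha]
  · obtain ⟨k, rfl⟩ := QuotientGroup.mk_surjective z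
    rw [hf ha]
    exact ofLoop_mem (hc.2 _ _ (A.toLoop_mem k a))
  · rw [loopShift_of_mem f hx, hf (ofLoop_mem hx), toLoop_ofLoop hx, toLoop_ofLoop (hc.2 k x hx)]

theorem isGradedCentralSimple_loop_iff :
    A.loop.IsGradedCentralSimple ↔ A.IsGradedCentralSimple := by
  constructor <;> rintro ⟨hS, hC⟩ <;> rw [isGradedCentral_iff] at hC
  · refine ⟨hS.of_loop, isGradedCentral_iff.2 fun f hf => ?_⟩
    obtain ⟨r, hr⟩ := hC _ (loopShift_mem_centroidComp (g := 1) hf)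
    refine ⟨r, (LinearMap.cancel_right ofLoop_surjective).1 (LinearMap.ext fun x => ?_)⟩
    rw [LinearMap.comp_apply, ← ofLoop_loopShift (g := 1) hf, hr]
    exact map_smul A.ofLoop r x
  · refine ⟨hS.loop, isGradedCentral_iff.2 fun c hc => ?_⟩
    obtain ⟨f, hf, rfl⟩ := hS.exists_eq_loopShift hc
    obtain ⟨r, rfl⟩ := hC f hf
    refine ⟨r, hom_ext fun k x hx => eq_of_ofLoop_eq (hc.2 k x hx) ?_ ?_⟩
    · rw [one_mul]
      exact Submodule.smul_mem _ r hx
    · rw [ofLoop_loopShift hf]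
      exact (map_smul A.ofLoop r x).symm

theorem centroidSupport_loop (hL : A.loop.IsGradedSimple) :
    centroidSupport hL = (centroidSupport hL.of_loop).comap (QuotientGroup.mk' H) := by
  refine Subgroup.ext fun g => ⟨?_, fun ⟨f, hf, hf0⟩ =>
    ⟨_, loopShift_mem_centroidComp hf, loopShift_ne_zero hf hf0⟩⟩
  rintro ⟨c, hc, hc0⟩
  obtain ⟨f, hf, rfl⟩ := hL.of_loop.exists_eq_loopShift hc
  refine ⟨f, hf, ?_⟩
  rintro rfl
  exact hc0 (hom_ext fun k x hx => by simp [loopShift_of_mem _ hx])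

theorem one_mem_centroidComp_mk (h : H) :
    (1 : Module.End F A.carrier) ∈ A.centroidComp (h : G) :=
  (QuotientGroup.eq_one_iff (h : G)).2 h.2 ▸ one_mem_centroidComp_one

variable (A) in
/-- The shifts of the loop algebra by the elements of `H`. -/
noncomputable def loopFrame [Nontrivial A.carrier] : CentralFrame A.loop H 1 where
  toFun h := A.loopShift h 1
  mem h := loopShift_mem_centroidComp (one_mem_centroidComp_mk h)
  ne_zero h := loopShift_ne_zero (one_mem_centroidComp_mk h) one_ne_zero
  mul h h' := hom_ext fun k x hx => by
    refine eq_of_ofLoop_eq (mul_assoc (h : G) h' k ▸ loopShift_mem 1 (loopShift_mem 1 hx))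
      (Submodule.smul_mem _ _ (loopShift_mem 1 hx)) ?_
    rw [LinearMap.smul_apply, map_smul, Module.End.mul_apply,
      ofLoop_loopShift (one_mem_centroidComp_mk h), ofLoop_loopShift (one_mem_centroidComp_mk h'),
      ofLoop_loopShift (one_mem_centroidComp_mk (h * h'))]
    exact (one_smul F _).symm

/-- The twisted isomorphism of loop algebras `a ⊗ g ↦ φ(a) ⊗ g`. -/
noncomputable def TwistedEquiv.loop {B : GradedAlg.{u, v, w₁} F (G ⧸ H)}
    {τ : SymCoh.Z2sym (G ⧸ H) Fˣ} (φ : TwistedEquiv τ A B) :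
    TwistedEquiv (SymCoh.Z2sym.pullback Fˣ (QuotientGroup.mk' H) τ) A.loop B.loop :=
  ofComponents
    (fun g => A.loopCompEquiv rfl ≪≫ₗ φ.compEquiv g ≪≫ₗ (B.loopCompEquiv (g := g) rfl).symm)
    fun g k x y => by
      have hx := ofLoop_mem x.2
      have hy := ofLoop_mem y.2
      change B.loop.mul (B.toLoop g (φ.toEquiv (A.ofLoop x)))
        (B.toLoop k (φ.toEquiv (A.ofLoop y))) =
          (τ.1 g k : F) • B.toLoop (g * k) (φ.toEquiv (A.ofLoop (A.loop.mul x y)))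
      rw [loop_mul_toLoop (φ.map_mem _ _ hx) (φ.map_mem _ _ hy), φ.map_mul _ _ _ hx _ hy, map_smul,
        ofLoop_mul]

end LoopCentroid

/-! ### Central simplicity and the support of the centroid -/

section CentralSimple

variable {A : GradedAlg.{u, v, w} F G}

/-- The component of degree `z` of a linear endomorphism. The sum over `z` of these components is
infinite in general, so an element of the centroid need not be a sum of homogeneous ones. -/
noncomputable def homComp (c : Module.End F A.carrier) (z : G) : Module.End F A.carrier :=
  A.lift fun y => (Finsupp.lapply (z * y) ∘ₗ A.comps ∘ₗ c).domRestrict (A.comp y)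

theorem homComp_of_mem (c : Module.End F A.carrier) (z : G) {y : G} {x : A.carrier}
    (hx : x ∈ A.comp y) : homComp c z x = A.comps (c x) (z * y) :=
  A.lift_of_mem _ hx

theorem homComp_mem_centroidComp {c : Module.End F A.carrier}
    (hc : c ∈ BilinAlg.centroid A.mul) (z : G) : homComp c z ∈ A.centroidComp z := by
  refine ⟨mem_centroid_of_homogeneous fun g k x hx y hy => ?_, fun g x hx => ?_⟩
  · rw [homComp_of_mem c z hx, homComp_of_mem c z hy, homComp_of_mem c z (A.mul_mem _ _ _ _ hx hy)]
    constructor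
    · rw [(hc _ _).1, ← comps_mul_right hy, mul_comm k, mul_assoc]
    · rw [(hc _ _).2, ← comps_mul_left hx, mul_left_comm]
  · rw [homComp_of_mem c z hx]
    exact comps_mem _ _

theorem IsGradedCentralSimple.centroid_eq_bot (hA : A.IsGradedCentralSimple)
    (h_supp : centroidSupport hA.1 = ⊥) : BilinAlg.centroid A.mul = ⊥ := by
  refine BilinAlg.centroid_eq_bot_iff.2 fun c hc => ?_
  obtain ⟨r, hr⟩ := isGradedCentral_iff.1 hA.2 _ (homComp_mem_centroidComp hc 1)
  refine ⟨r, hom_ext fun g x hx => comps_injective <| Finsupp.ext fun k => ?_⟩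
  rw [LinearMap.smul_apply, Module.End.one_apply, map_smul, Finsupp.smul_apply]
  by_cases hk : k = g
  · rw [hk, comps_self hx, ← one_mul g, ← homComp_of_mem c 1 hx, hr]
    simp
  · have h_zero : homComp c (k * g⁻¹) = 0 := by
      by_contra h_ne
      have h_mem : k * g⁻¹ ∈ centroidSupport hA.1 := ⟨_, homComp_mem_centroidComp hc _, h_ne⟩
      exact hk (mul_inv_eq_one.1 (Subgroup.mem_bot.1 (h_supp ▸ h_mem)))
    rw [comps_ne hx hk, smul_zero, ← inv_mul_cancel_right k g, ← homComp_of_mem c _ hx, h_zero,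
      LinearMap.zero_apply]

/-- If the subspaces `V y` are permuted by multiplication with homogeneous elements, and each
element of `V y` is determined by its component of degree `y`, then sending `b ∈ A_y` to the
element of `V y` with component `b` defines an element of the centroid. -/
theorem IsGradedSimple.exists_mem_centroid_comps_eq (hA : A.IsGradedSimple)
    {V : G → Submodule F A.carrier}
    (h_mul : ∀ g y, ∀ b ∈ A.comp g, ∀ u ∈ V y, A.mul b u ∈ V (g * y) ∧ A.mul u b ∈ V (g * y))
    (h_inj : ∀ y, ∀ u ∈ V y, A.comps u y = 0 → u = 0)
    {y₀ : G} {a : A.carrier} (ha : a ∈ V y₀) (ha0 : a ≠ 0) :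
    ∃ T ∈ BilinAlg.centroid A.mul, ∀ y, ∀ b ∈ A.comp y, T b ∈ V y ∧ A.comps (T b) y = b := by
  let ev (y : G) : V y →ₗ[F] A.comp y :=
    ((Finsupp.lapply y ∘ₗ A.comps).domRestrict (V y)).codRestrict _ fun u => comps_mem _ y
  have h_ideal : A.IsIdealFamily fun y => (V y).map (Finsupp.lapply y ∘ₗ A.comps) := by
    rintro g k b hb _ - ⟨u, hu, rfl⟩
    exact ⟨⟨_, (h_mul g k b hb u hu).1, comps_mul_left hb u k⟩,
      ⟨_, (h_mul g k b hb u hu).2, comps_mul_right hb u k⟩⟩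
  have h_bij (y : G) : Function.Bijective (ev y) := by
    refine ⟨(injective_iff_map_eq_zero _).2 fun u hu =>
      Subtype.ext (h_inj y u u.2 (congrArg Subtype.val hu)), fun b => ?_⟩
    obtain ⟨u, hu, hub⟩ := hA.comp_le_of_isIdealFamily h_ideal (comps_mem a y₀) ⟨a, ha, rfl⟩
      (fun h => ha0 (h_inj y₀ a ha h)) y b.2
    exact ⟨⟨u, hu⟩, Subtype.ext hub⟩
  let e (y : G) : V y ≃ₗ[F] A.comp y := LinearEquiv.ofBijective (ev y) (h_bij y)
  let T : Module.End F A.carrier := A.lift fun y => (V y).subtype ∘ₗ (e y).symm.toLinearMap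
  have hT : ∀ y, ∀ b ∈ A.comp y, T b ∈ V y ∧ A.comps (T b) y = b := fun y b hb => by
    rw [A.lift_of_mem _ hb]
    exact ⟨Subtype.prop _, congrArg Subtype.val ((e y).apply_symm_apply ⟨b, hb⟩)⟩
  have hT_unique : ∀ y, ∀ b ∈ A.comp y, ∀ u ∈ V y, A.comps u y = b → T b = u :=
    fun y b hb u hu hub => sub_eq_zero.1 <| h_inj y _ (sub_mem (hT y b hb).1 hu) <| by
      rw [map_sub, Finsupp.sub_apply, (hT y b hb).2, hub, sub_self]
  refine ⟨T, mem_centroid_of_homogeneous fun g k x hx y hy => ?_, hT⟩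
  have h_left := h_mul k g y hy _ (hT g x hx).1
  have h_right := h_mul g k x hx _ (hT k y hy).1
  refine ⟨hT_unique _ _ (A.mul_mem _ _ _ _ hx hy) _ (mul_comm k g ▸ h_left.2) ?_,
    hT_unique _ _ (A.mul_mem _ _ _ _ hx hy) _ h_right.1 ?_⟩
  · rw [mul_comm g k, comps_mul_right hy, (hT g x hx).2]
  · rw [comps_mul_left hx, (hT k y hy).2]

/-- The elements of `J` whose support is contained in the translate by `t` of the support
of `a`. -/
noncomputable def supportedIn (J : Submodule F A.carrier) (a : A.carrier) (t : G) :
    Submodule F A.carrier :=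
  J ⊓ ⨅ z, ⨅ _ : A.comps a z = 0, LinearMap.ker (Finsupp.lapply (t * z) ∘ₗ A.comps)

theorem mem_supportedIn {J : Submodule F A.carrier} {a u : A.carrier} {t : G} :
    u ∈ supportedIn J a t ↔ u ∈ J ∧ ∀ z, A.comps a z = 0 → A.comps u (t * z) = 0 := by
  simp [supportedIn, Submodule.mem_iInf]

theorem mul_mem_supportedIn {J : Submodule F A.carrier} (hJ : BilinAlg.IsIdeal A.mul J)
    {a b u : A.carrier} {g t : G} (hb : b ∈ A.comp g) (hu : u ∈ supportedIn J a t) :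
    A.mul b u ∈ supportedIn J a (g * t) ∧ A.mul u b ∈ supportedIn J a (g * t) := by
  rw [mem_supportedIn] at hu
  simp only [mem_supportedIn, mul_assoc, comps_mul_left hb, comps_mul_right hb]
  exact ⟨⟨(hJ b u hu.1).1, fun z hz => by rw [hu.2 z hz, map_zero]⟩,
    ⟨(hJ b u hu.1).2, fun z hz => by rw [hu.2 z hz, map_zero, LinearMap.zero_apply]⟩⟩

theorem eq_zero_of_mem_supportedIn {J : Submodule F A.carrier} {a : A.carrier}
    (h_min : ∀ u ∈ J, u ≠ 0 → (A.comps a).support.card ≤ (A.comps u).support.card)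
    {u : A.carrier} {t x₀ : G} (hx₀ : A.comps a x₀ ≠ 0) (hu : u ∈ supportedIn J a t)
    (h_zero : A.comps u (t * x₀) = 0) : u = 0 := by
  classical
  rw [mem_supportedIn] at hu
  have h_ssubset : ((A.comps u).support.image (t⁻¹ * ·)) ⊂ (A.comps a).support := by
    refine (Finset.ssubset_iff_of_subset fun z hz => ?_).2
      ⟨x₀, Finsupp.mem_support_iff.2 hx₀, fun hz => ?_⟩ <;>
    obtain ⟨y, hy, rfl⟩ := Finset.mem_image.1 hz <;>
    rw [Finsupp.mem_support_iff] at hy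
    · exact Finsupp.mem_support_iff.2 fun h => hy (by simpa using hu.2 _ h)
    · exact hy (by simpa using h_zero)
  by_contra hu0
  have h_lt := Finset.card_lt_card h_ssubset
  rw [Finset.card_image_of_injective _ (mul_right_injective _)] at h_lt
  exact (h_min u hu.1 hu0).not_gt h_lt

theorem IsGradedSimple.exists_mem_centroid_range_le (hA : A.IsGradedSimple)
    {J : Submodule F A.carrier} (hJ : BilinAlg.IsIdeal A.mul J) (hJ0 : J ≠ ⊥) :
    ∃ T ∈ BilinAlg.centroid A.mul, T ≠ 0 ∧ LinearMap.range T ≤ J := by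
  obtain ⟨a, ⟨haJ, ha0⟩, h_min⟩ := exists_minimalFor_of_wellFoundedLT (fun u => u ∈ J ∧ u ≠ 0)
    (fun u => (A.comps u).support.card) (Submodule.exists_mem_ne_zero_of_ne_bot hJ0)
  have h_card : ∀ u ∈ J, u ≠ 0 → (A.comps a).support.card ≤ (A.comps u).support.card :=
    fun u hu hu0 => le_of_not_gt fun h => h.not_ge (h_min ⟨hu, hu0⟩ h.le)
  obtain ⟨x₀, hx₀⟩ := exists_comps_ne_zero ha0
  have ha : a ∈ supportedIn J a (x₀ * x₀⁻¹) :=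
    mem_supportedIn.2 ⟨haJ, fun z hz => by rwa [mul_inv_cancel, one_mul]⟩
  obtain ⟨T, hT, hTV⟩ := hA.exists_mem_centroid_comps_eq
    (V := fun y => supportedIn J a (y * x₀⁻¹))
    (fun g y b hb u hu => by simpa only [mul_assoc] using mul_mem_supportedIn hJ hb hu)
    (fun y u hu h => eq_zero_of_mem_supportedIn h_card hx₀ hu (by rwa [inv_mul_cancel_right]))
    ha ha0
  refine ⟨T, hT, fun h => hx₀ ?_, ?_⟩
  · rw [← (hTV x₀ _ (comps_mem a x₀)).2, h, LinearMap.zero_apply, map_zero, Finsupp.zero_apply]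
  · rintro _ ⟨x, rfl⟩
    exact mem_of_comp_le (P := J.comap T) (fun y b hb => (mem_supportedIn.1 (hTV y b hb).1).1) x

theorem IsGradedSimple.isCentralSimple (hA : A.IsGradedSimple)
    (h_centroid : BilinAlg.centroid A.mul = ⊥) : A.IsCentralSimple := by
  refine ⟨⟨hA.1, hA.2.1, fun J hJ => or_iff_not_imp_left.2 fun hJ0 => ?_⟩, h_centroid⟩
  obtain ⟨T, hT, hT0, hTJ⟩ := hA.exists_mem_centroid_range_le hJ hJ0
  obtain ⟨r, rfl⟩ := BilinAlg.centroid_eq_bot_iff.1 h_centroid T hT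
  have hr : r ≠ 0 := fun h => hT0 (by rw [h, zero_smul])
  refine Submodule.eq_top_iff'.2 fun x => hTJ ⟨r⁻¹ • x, ?_⟩
  rw [LinearMap.smul_apply, Module.End.one_apply, smul_inv_smul₀ hr]

theorem isCentralSimple_iff :
    A.IsCentralSimple ↔ ∃ hA : A.IsGradedCentralSimple, centroidSupport hA.1 = ⊥ := by
  refine ⟨fun ⟨⟨h_nontrivial, h_sq, h_ideals⟩, h_centroid⟩ => ?_,
    fun ⟨hA, h_supp⟩ => hA.1.isCentralSimple (hA.centroid_eq_bot h_supp)⟩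
  have h_scalar := BilinAlg.centroid_eq_bot_iff.1 h_centroid
  have hA : A.IsGradedCentralSimple :=
    ⟨⟨h_nontrivial, h_sq, fun I hI => h_ideals I hI.1⟩,
      isGradedCentral_iff.2 fun c hc => h_scalar c hc.1⟩
  refine ⟨hA, (Subgroup.eq_bot_iff_forall _).2 ?_⟩
  rintro z ⟨c, hc, hc0⟩
  obtain ⟨r, rfl⟩ := h_scalar c hc.1
  obtain ⟨g, x, hx, hx0⟩ := hA.1.exists_mem_comp_ne_zero
  have h_ne : (r • (1 : Module.End F A.carrier)) x ≠ 0 := fun h =>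
    hx0 ((smul_eq_zero.1 h).resolve_left fun hr => hc0 (by rw [hr, zero_smul]))
  by_contra hz
  exact h_ne (eq_zero_of_mem_of_mem (Submodule.smul_mem _ r hx) (hc.2 g x hx) (by simpa using hz))

variable {H : Subgroup G} {B : GradedAlg.{u, v, w} F (G ⧸ H)}

theorem isCentralSimple_iff_loop :
    B.IsCentralSimple ↔ ∃ hB : B.loop.IsGradedCentralSimple, centroidSupport hB.1 = H := by
  rw [isCentralSimple_iff]
  have h_comap (K : Subgroup (G ⧸ H)) : K.comap (QuotientGroup.mk' H) = H ↔ K = ⊥ := by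
    rw [← (Subgroup.comap_injective (QuotientGroup.mk'_surjective H)).eq_iff,
      MonoidHom.comap_bot, QuotientGroup.ker_mk']
  refine ⟨fun ⟨hB, h⟩ => ?_, fun ⟨hL, h⟩ => ?_⟩
  · exact ⟨isGradedCentralSimple_loop_iff.2 hB, (centroidSupport_loop _).trans ((h_comap _).2 h)⟩
  · exact ⟨isGradedCentralSimple_loop_iff.1 hL,
      (h_comap _).1 ((centroidSupport_loop hL.1).symm.trans h)⟩

end CentralSimple

/-! ### Central images -/

section CentralImage

variable {B : GradedAlg.{u, v, w} F G} {H : Subgroup G} (s : QuotSection H)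
  (Z : H →* Module.End F B.carrier)

/-- The linear map that moves each homogeneous element `x` by the operators `Z h` into the
degree `s(gH)` selected in the coset of the degree `g` of `x`. -/
noncomputable def normalize : B.carrier →ₗ[F] B.carrier :=
  B.lift fun g => (Z (s.offset g)).domRestrict (B.comp g)

theorem normalize_of_mem {g : G} {x : B.carrier} (hx : x ∈ B.comp g) :
    normalize s Z x = Z (s.offset g) x :=
  B.lift_of_mem _ hx

theorem normalize_of_mem_section {z : G ⧸ H} {x : B.carrier} (hx : x ∈ B.comp (s.1 z)) :
    normalize s Z x = x := by
  rw [normalize_of_mem s Z hx, s.offset_section, map_one, Module.End.one_apply]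

variable {Z} (hZ : ∀ h : H, Z h ∈ B.centroidComp h)
include hZ

theorem normalize_mem {g : G} {x : B.carrier} (hx : x ∈ B.comp g) :
    normalize s Z x ∈ B.comp (s.1 g) := by
  rw [normalize_of_mem s Z hx, ← s.offset_mul_coe]
  exact (hZ _).2 g x hx

theorem normalize_apply (h : H) (x : B.carrier) : normalize s Z (Z h x) = normalize s Z x := by
  suffices h_eq : normalize s Z ∘ₗ Z h = normalize s Z from LinearMap.congr_fun h_eq x
  refine hom_ext fun g x hx => ?_
  rw [LinearMap.comp_apply, normalize_of_mem s Z hx, normalize_of_mem s Z ((hZ h).2 g x hx),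
    ← Module.End.mul_apply, ← map_mul, s.offset_coe_mul_mul]

theorem normalize_mul_normalize (x y : B.carrier) :
    normalize s Z (B.mul (normalize s Z x) (normalize s Z y)) = normalize s Z (B.mul x y) := by
  have h_eq := B.bilin_ext ((B.mul.compl₁₂ (normalize s Z) (normalize s Z)).compr₂ (normalize s Z))
    (B.mul.compr₂ (normalize s Z)) fun g k x hx y hy => by
      rw [LinearMap.compr₂_apply, LinearMap.compl₁₂_apply, LinearMap.compr₂_apply,
        normalize_of_mem s Z hx, normalize_of_mem s Z hy, ← ((hZ _).1 _ _).1,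
        normalize_apply s hZ, ← ((hZ _).1 _ _).2, normalize_apply s hZ]
  exact LinearMap.congr_fun₂ h_eq x y

/-- The algebra obtained from `B` by identifying each `x` with all `Z h x`, graded by `G/H`. It is
realized on the sum of the components `B_{s(z)}`, `z ∈ G/H`, with the normalized product of `B`. -/
noncomputable def centralImage : GradedAlg.{u, v, w} F (G ⧸ H) where
  carrier := LinearMap.range (normalize s Z)
  mul := (B.mul.compl₁₂ (LinearMap.range (normalize s Z)).subtype
    (LinearMap.range (normalize s Z)).subtype).compr₂ (normalize s Z).rangeRestrict
  comp z := (B.comp (s.1 z)).comap (LinearMap.range (normalize s Z)).subtype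
  indep z := by
    have h_disjoint := B.indep.comp (Function.LeftInverse.injective s.2) z
    refine Disjoint.mono_right (iSup₂_le fun y hy => Submodule.comap_mono
      (le_iSup₂_of_le (f := fun y (_ : y ≠ z) => B.comp (s.1 y)) y hy le_rfl)) ?_
    rw [disjoint_iff, ← Submodule.comap_inf]
    exact (congrArg _ h_disjoint.eq_bot).trans (Submodule.ker_subtype _)
  iSup_eq_top := by
    refine Submodule.eq_top_iff'.2 ?_
    rintro ⟨_, x, rfl⟩
    refine mem_of_comp_le (P := (⨆ z, (B.comp (s.1 z)).comap
      (LinearMap.range (normalize s Z)).subtype).comap (normalize s Z).rangeRestrict)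
      (fun g x hx => ?_) x
    exact Submodule.mem_iSup_of_mem (g : G ⧸ H) (normalize_mem s hZ hx)
  mul_mem y z a b ha hb := by
    have h_mem := normalize_mem s hZ (B.mul_mem _ _ _ _ ha hb)
    rwa [QuotientGroup.mk_mul, s.2, s.2] at h_mem

/-- The normalization, as a linear isomorphism of homogeneous components. -/
noncomputable def compEquivCentralImage (g : G) :
    B.comp g ≃ₗ[F] (centralImage s hZ).comp (g : G ⧸ H) :=
  LinearEquiv.ofBijective
    (((normalize s Z).rangeRestrict.domRestrict (B.comp g)).codRestrict
      ((centralImage s hZ).comp (g : G ⧸ H)) fun x => normalize_mem s hZ x.2) <| by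
    have h_inv (h : H) (x : B.carrier) : Z h⁻¹ (Z h x) = x := by
      rw [← Module.End.mul_apply, ← map_mul, inv_mul_cancel, map_one, Module.End.one_apply]
    refine ⟨fun x y h_eq => Subtype.ext ?_, fun ⟨a, ha⟩ => ?_⟩
    · have h_coe : Z (s.offset g) x = Z (s.offset g) y := by
        rw [← normalize_of_mem s Z x.2, ← normalize_of_mem s Z y.2]
        exact congrArg (fun a => (a.1.1 : B.carrier)) h_eq
      rw [← h_inv (s.offset g) x, h_coe, h_inv]
    · have h_mem : Z (s.offset g)⁻¹ a.1 ∈ B.comp g := by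
        have h := (hZ (s.offset g)⁻¹).2 _ _ ha
        rwa [← s.offset_mul_coe, Subgroup.coe_inv, inv_mul_cancel_left] at h
      refine ⟨⟨_, h_mem⟩, Subtype.ext (Subtype.ext ?_)⟩
      exact (normalize_apply s hZ _ _).trans (normalize_of_mem_section s Z ha)

/-- The isomorphism `x ↦ normalize x ⊗ g`, for `x ∈ B_g`, onto the loop algebra of the central
image. -/
noncomputable def equivLoopCentralImage : TwistedEquiv 1 B (centralImage s hZ).loop :=
  TwistedEquiv.ofComponents
    (fun g => compEquivCentralImage s hZ g ≪≫ₗ ((centralImage s hZ).loopCompEquiv rfl).symm)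
    fun g k x y => by
      have h_mul : (centralImage s hZ).mul ((normalize s Z).rangeRestrict x)
          ((normalize s Z).rangeRestrict y) = (normalize s Z).rangeRestrict (B.mul x y) :=
        Subtype.ext (normalize_mul_normalize s hZ _ _)
      refine ((centralImage s hZ).loop_mul_toLoop (normalize_mem s hZ x.2)
        (normalize_mem s hZ y.2)).trans ?_
      exact (congrArg _ h_mul).trans (one_smul F _).symm

end CentralImage

section TwistedLoop

variable {H : Subgroup G} {A A' : GradedAlg.{u, v, w} F (G ⧸ H)} {τ τ' : SymCoh.Z2sym G Fˣ}

theorem IsCentralSimple.isGradedCentralSimple_twistedLoop (hA : A.IsCentralSimple)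
    (τ : SymCoh.Z2sym G Fˣ) : (A.twistedLoop τ).IsGradedCentralSimple := by
  obtain ⟨hL, -⟩ := isCentralSimple_iff_loop.1 hA
  obtain ⟨ι⟩ := nonempty_twistedEquiv_twist A.loop τ
  exact ι.isGradedCentralSimple hL

theorem iso_twistedLoop {s : QuotSection H} {χ : H →* Fˣ} (h : Iso (A.charTwist s χ) A')
    (hτ : (τ : SymCoh.H2sym G Fˣ) = τ') : Iso (A.twistedLoop τ) (A'.twistedLoop τ') := by
  obtain ⟨φ⟩ := (iso_twist_iff_nonempty A A' _).1 h
  obtain ⟨γ, rfl⟩ := SymCoh.mk_eq_mk_iff.1 hτ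
  have ψ : TwistedEquiv 1 A.loop A'.loop :=
    ((TwistedEquiv.rescale A.loop (χ ∘ s.offset)).symm.trans φ.loop).cast
      (by rw [s.pullback_mk_charCocycle, inv_mul_cancel])
  exact (iso_twist_twist_iff _ _ _ _).2 ⟨((TwistedEquiv.rescale A.loop γ).symm.trans ψ).cast
    (by rw [mul_one, mul_inv, mul_inv_cancel_left])⟩

theorem subgroup_eq_of_twistedEquiv_loop {H' : Subgroup G} {B : GradedAlg.{u, v, w} F (G ⧸ H')}
    (hA : A.IsCentralSimple) (hB : B.IsCentralSimple) (φ : TwistedEquiv τ A.loop B.loop) :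
    H = H' := by
  obtain ⟨hA, h_suppA⟩ := isCentralSimple_iff_loop.1 hA
  obtain ⟨hB, h_suppB⟩ := isCentralSimple_iff_loop.1 hB
  rw [← h_suppA, ← h_suppB, φ.centroidSupport_eq hA.1 hB.1]

theorem exists_conj_loopShift_eq_smul (hA : A.IsCentralSimple) (hA' : A'.IsCentralSimple)
    (φ : TwistedEquiv τ A.loop A'.loop) :
    ∃ γ : H → Fˣ, (∀ h : H, φ.conj h (A.loopShift h 1) = (γ h : F) • A'.loopShift h 1) ∧
      SymCoh.Z2sym.pullback Fˣ H.subtype τ = SymCoh.coboundary γ := by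
  have := hA.1.1
  have := hA'.1.1
  obtain ⟨hL', -⟩ := isCentralSimple_iff_loop.1 hA'
  obtain ⟨γ, hγ, h_coboundary⟩ := A'.loopFrame.exists_eq_smul hL' (A.loopFrame.conj φ)
  exact ⟨γ, hγ, by rwa [mul_one, one_mul] at h_coboundary⟩

theorem pullback_mk_eq_of_iso_twistedLoop (hA : A.IsCentralSimple) (hA' : A'.IsCentralSimple)
    (h : Iso (A.twistedLoop τ) (A'.twistedLoop τ')) :
    SymCoh.H2sym.pullback Fˣ H.subtype τ = SymCoh.H2sym.pullback Fˣ H.subtype τ' := by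
  obtain ⟨φ⟩ := (iso_twist_twist_iff _ _ _ _).1 h
  obtain ⟨γ, -, hγ⟩ := exists_conj_loopShift_eq_smul hA hA' φ
  refine (SymCoh.mk_eq_mk_iff.2 ⟨γ, ?_⟩).symm
  rw [← hγ, ← map_mul, mul_comm, inv_mul_cancel_right]

theorem exists_character_ofLoop_eq_smul (hA : A.IsCentralSimple) (hA' : A'.IsCentralSimple)
    (φ : TwistedEquiv 1 A.loop A'.loop) :
    ∃ χ : H →* Fˣ, ∀ (h : H) (k : G), ∀ a ∈ A.comp k,
      A'.ofLoop (φ.toEquiv (A.toLoop (h * k) a)) =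
        (χ h : F) • A'.ofLoop (φ.toEquiv (A.toLoop k a)) := by
  obtain ⟨γ, hγ, h_coboundary⟩ := exists_conj_loopShift_eq_smul hA hA' φ
  have h_mul (h k : H) : γ (h * k) = γ h * γ k := by
    rw [← SymCoh.coboundary_apply_mul, ← h_coboundary]
    exact (one_mul _).symm
  refine ⟨MonoidHom.mk' γ h_mul, fun h k a ha => ?_⟩
  have h_shift : A.loopShift h 1 (A.toLoop k a) = A.toLoop (h * k) a := by
    rw [loopShift_of_mem _ (A.toLoop_mem k a), ofLoop_toLoop ha, Module.End.one_apply]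
  calc A'.ofLoop (φ.toEquiv (A.toLoop (h * k) a))
      = A'.ofLoop (φ.conj h (A.loopShift h 1) (φ.toEquiv (A.toLoop k a))) := by
        rw [φ.conj_apply _ _ (A.toLoop_mem k a), h_shift]
        exact congrArg _ (one_smul F _).symm
    _ = (γ h : F) • A'.ofLoop (φ.toEquiv (A.toLoop k a)) := by
        rw [hγ, LinearMap.smul_apply, map_smul, ofLoop_loopShift (one_mem_centroidComp_mk h),
          Module.End.one_apply]

theorem exists_iso_charTwist (hA : A.IsCentralSimple) (hA' : A'.IsCentralSimple)
    (φ : TwistedEquiv 1 A.loop A'.loop) (s : QuotSection H) :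
    ∃ χ : H →* Fˣ, Iso (A.charTwist s χ) A' := by
  obtain ⟨χ, hχ⟩ := exists_character_ofLoop_eq_smul hA hA' φ
  refine ⟨χ, (iso_twist_iff_nonempty A A' _).2 ⟨TwistedEquiv.ofComponents
    (fun z => (A.loopCompEquiv (s.2 z)).symm ≪≫ₗ φ.compEquiv (s.1 z) ≪≫ₗ
      A'.loopCompEquiv (s.2 z)) fun y z a b => ?_⟩⟩
  obtain ⟨a, ha⟩ := a
  obtain ⟨b, hb⟩ := b
  have h_section {z : G ⧸ H} {c : A.carrier} (hc : c ∈ A.comp z) : c ∈ A.comp (s.1 z) :=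
    (s.2 z).symm ▸ hc
  calc A'.mul (A'.ofLoop (φ.toEquiv (A.toLoop (s.1 y) a)))
        (A'.ofLoop (φ.toEquiv (A.toLoop (s.1 z) b)))
      = A'.ofLoop (φ.toEquiv (A.toLoop (s.1 y * s.1 z) (A.mul a b))) := by
        rw [← ofLoop_mul, φ.map_mul _ _ _ (A.toLoop_mem _ a) _ (A.toLoop_mem _ b),
          loop_mul_toLoop (h_section ha) (h_section hb)]
        exact congrArg _ (one_smul F _)
    _ = (χ (s.sigma y z) : F) • A'.ofLoop (φ.toEquiv (A.toLoop (s.1 (y * z)) (A.mul a b))) := by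
        rw [← hχ _ _ _ (h_section (A.mul_mem y z a b ha hb))]
        simp only [QuotSection.sigma, inv_mul_cancel_right]

theorem exists_iso_twistedLoop {B : GradedAlg.{u, v, max v w} F G}
    (hB : B.IsGradedCentralSimple) :
    ∃ (H : Subgroup G) (c : SymCoh.H2sym H Fˣ), ∀ τ : SymCoh.Z2sym G Fˣ,
      SymCoh.H2sym.pullback Fˣ H.subtype τ = c →
        ∃ A : GradedAlg.{u, v, max v w} F (G ⧸ H), A.IsCentralSimple ∧ Iso (A.twistedLoop τ) B := by
  obtain ⟨σ, ⟨X⟩⟩ := CentralFrame.exists_centroidSupport hB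
  refine ⟨centroidSupport hB.1, σ, fun τ hτ => ?_⟩
  obtain ⟨γ, hγ⟩ := SymCoh.mk_eq_mk_iff.1 hτ.symm
  obtain ⟨ι⟩ := nonempty_twistedEquiv_twist B τ⁻¹
  have hι := ι.isGradedCentralSimple hB
  let Y : CentralFrame (B.twist τ⁻¹) (centroidSupport hB.1) 1 :=
    ((X.rescale γ).conj ι).cast (by rw [← hγ, map_inv, inv_mul_cancel])
  let A := centralImage ⟨Quotient.out, QuotientGroup.out_eq'⟩ (Z := Y.toMonoidHom hι.1) Y.mem
  let φ : TwistedEquiv τ⁻¹ B A.loop :=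
    (ι.trans (equivLoopCentralImage _ Y.mem)).cast (mul_one _)
  have hL := φ.isGradedCentralSimple hB
  exact ⟨A, isCentralSimple_iff_loop.2 ⟨hL, (φ.centroidSupport_eq hB.1 hL.1).symm⟩,
    (iso_twist_iff_nonempty _ _ _).2 ⟨φ.symm.cast (inv_inv τ)⟩⟩

end TwistedLoop

/-! ### The classification -/

section Classification

variable (s : ∀ H : Subgroup G, QuotSection H)
  (ξ : ∀ H : Subgroup G, SymCoh.H2sym H Fˣ → SymCoh.H2sym G Fˣ)

/-- The map `(H, [τ'], [A]) ↦ [L_π^τ(A)]` of the classification, computed with the representative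
`τ` of `ξ_H([τ'])` chosen by `Quotient.out`. -/
noncomputable def loopClass (T : Triple.{u, v, max v w} F s) : GCSClass.{u, v, max v w} F G :=
  Quotient.lift (s := charSetoid F (s T.1))
    (fun A : {A : GradedAlg.{u, v, max v w} F (G ⧸ T.1) // A.IsCentralSimple} =>
      Quotient.mk (gcsSetoid F G)
        ⟨A.1.twistedLoop (ξ T.1 T.2.1).out, A.2.isGradedCentralSimple_twistedLoop _⟩)
    (fun _ _ ⟨_, h⟩ => Quotient.sound (iso_twistedLoop h rfl)) T.2.2

theorem loopClass_mk {H : Subgroup G} {τ' : SymCoh.H2sym H Fˣ} {τ : SymCoh.Z2sym G Fˣ}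
    (hτ : (τ : SymCoh.H2sym G Fˣ) = ξ H τ')
    (A : {A : GradedAlg.{u, v, max v w} F (G ⧸ H) // A.IsCentralSimple}) :
    loopClass.{u, v, w} s ξ ⟨H, τ', Quotient.mk (charSetoid F (s H)) A⟩ =
      Quotient.mk (gcsSetoid F G)
        ⟨A.1.twistedLoop τ, A.2.isGradedCentralSimple_twistedLoop τ⟩ := by
  obtain ⟨χ, h⟩ := (charSetoid F (s H)).refl A
  exact Quotient.sound (iso_twistedLoop h ((QuotientGroup.out_eq' _).trans hτ.symm))

variable {s ξ} (hξ : ∀ H : Subgroup G, Function.RightInverse (ξ H)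
  (SymCoh.H2sym.pullback Fˣ H.subtype))

include hξ

theorem loopClass_injective : Function.Injective (loopClass.{u, v, w} s ξ) := by
  rintro ⟨H, c, q⟩ ⟨H', c', q'⟩ h_eq
  induction q using Quotient.inductionOn with | _ A
  induction q' using Quotient.inductionOn with | _ A'
  have h_iso : Iso (A.1.twistedLoop (ξ H c).out) (A'.1.twistedLoop (ξ H' c').out) :=
    Quotient.exact h_eq
  obtain ⟨φ⟩ := (iso_twist_twist_iff _ _ _ _).1 h_iso
  obtain rfl := subgroup_eq_of_twistedEquiv_loop A.2 A'.2 φ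
  obtain rfl : c = c' := by
    simpa only [QuotientGroup.out_eq', hξ H _] using
      pullback_mk_eq_of_iso_twistedLoop A.2 A'.2 h_iso
  obtain ⟨χ, h⟩ := exists_iso_charTwist A.2 A'.2 (φ.cast (mul_inv_cancel _)) (s H)
  have h_class : Quotient.mk (charSetoid F (s H)) A = Quotient.mk (charSetoid F (s H)) A' :=
    Quotient.sound ⟨χ, h⟩
  rw [h_class]

theorem loopClass_surjective : Function.Surjective (loopClass.{u, v, w} s ξ) := by
  intro q
  induction q using Quotient.inductionOn with | _ B
  obtain ⟨H, c, h_exists⟩ := exists_iso_twistedLoop.{u, v, w} B.2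
  obtain ⟨τ, hτ⟩ := QuotientGroup.mk_surjective (ξ H c)
  obtain ⟨A, hA, h_iso⟩ := h_exists τ (by rw [hτ, hξ])
  refine ⟨⟨H, c, Quotient.mk (charSetoid F (s H)) ⟨A, hA⟩⟩, ?_⟩
  rw [loopClass_mk s ξ hτ]
  exact Quotient.sound h_iso

end Classification

end GradedAlg

theorem corollary4p5 (F : Type u) [Field F] (G : Type v) [CommGroup G]
    (s : ∀ H : Subgroup G, QuotSection H)
    (ξ : ∀ H : Subgroup G, SymCoh.H2sym H Fˣ → SymCoh.H2sym G Fˣ)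
    (hξ : ∀ H : Subgroup G, Function.RightInverse (ξ H) (SymCoh.H2sym.pullback Fˣ H.subtype)) :
    ∃ (hL : ∀ (H : Subgroup G) (τ : SymCoh.Z2sym G Fˣ)
        (A : GradedAlg.{u, v, max v w} F (G ⧸ H)), A.IsCentralSimple →
        (A.twistedLoop τ).IsGradedCentralSimple)
      (Φ : GradedAlg.Triple.{u, v, max v w} F s → GradedAlg.GCSClass.{u, v, max v w} F G),
      (∀ (H : Subgroup G) (τ' : SymCoh.H2sym H Fˣ)
        (A : {A : GradedAlg.{u, v, max v w} F (G ⧸ H) // A.IsCentralSimple})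
        (τ : SymCoh.Z2sym G Fˣ), (QuotientGroup.mk τ : SymCoh.H2sym G Fˣ) = ξ H τ' →
        Φ ⟨H, τ', Quotient.mk (GradedAlg.charSetoid F (s H)) A⟩ =
          Quotient.mk (GradedAlg.gcsSetoid F G) ⟨A.1.twistedLoop τ, hL H τ A.1 A.2⟩) ∧
      Function.Bijective Φ :=
  ⟨fun _ τ _ hA => hA.isGradedCentralSimple_twistedLoop τ,
    GradedAlg.loopClass s ξ,
    fun _ _ A _ hτ => GradedAlg.loopClass_mk s ξ hτ A,
    GradedAlg.loopClass_injective hξ, GradedAlg.loopClass_surjective hξ⟩
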